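/- **Setting.** Let $f:\mathbb{R}^n\to\mathbb{R}$ be convex and three times continuously differentiable with $\|D^3f(x)-D^3f(y)\|\le L_f\|x-y\|$ for all $x,y$ (Euclidean norm and the induced tensor norm), let $\psi:\mathbb{R}^n\to\mathbb{R}\cup\{+\infty\}$ be convex, $\tilde f=f+\psi$, and let $x^*$ be a minimizer of $\tilde f$. For $x\in\mathbb{R}^n$, $M>0$ put $d_4(h)=\frac14\|h\|^4$, $$\Omega_{x,M}(y)=f(x)+\sum_{i=1}^{3}\tfrac1{i!}D^if(x)[y-x]^i+\tfrac M2 d_4(y-x),\qquad \rho_x(y)=\tfrac12\langle\nabla^2f(x)(y-x),y-x\rangle+\tfrac M2d_4(y-x),$$ and $\beta_{\rho_x}(u,v)=\rho_x(v)-\rho_x(u)-\langle\nabla\rho_x(u),v-u\rangle$. **Algorithm 1** (input $x\in\operatorname{dom}\psi$, $G\in\partial\tilde f(x)$, $M,\epsilon>0$). Let $$L_{x,M}=\operatorname{trace}\nabla^2f(x)+\tfrac{3M}{2}\Big[\tfrac{96\|G\|}{M}\Big]^{2/3},\qquad \beta_{x,M}=\tfrac12\operatorname{trace}\nabla^2f(x)\Big[\tfrac{96\|G\|}{M}\Big]^{2/3}+\tfrac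 M8\Big[\tfrac{96\|G\|}{M}\Big]^{4/3}.$$ Start with $y_0=x$. For $k=0,1,\dots$ compute $y_{k+1}\in\arg\min_y\{\langle\nabla\Omega_{x,M}(y_k),y-y_k\rangle+3\beta_{\rho_x}(y_k,y)+\psi(y)\}$, $g_\psi(y_{k+1})=-\nabla\Omega_{x,M}(y_k)+3[\nabla\rho_x(y_k)-\nabla\rho_x(y_{k+1})]$ and $r_{k+1}=\|\nabla\Omega_{x,M}(y_{k+1})+g_\psi(y_{k+1})\|$. If $r_{k+1}\le\epsilon/7$ or $r_{k+1}\le\frac M6\|y_{k+1}-x\|^3$, stop and return $(x^+,\alpha)=(y_{k+1},0)$. Otherwise, if $r_{k+1}^4>\frac{3^8L_{x,M}^4\beta_{x,M}}{2M(6/5)^k}$, stop and return $(x^+,\alpha)=(y_{k+1},1)$. Otherwise continue with $k+1$. **Algorithm 2** (input $x_0\in\operatorname{dom}\psi$, $M_0,\epsilon>0$). In iteration $t=0,1,\dots$, starting from the smallest $i\ge0$ with $2^iM_t\ge2M_0$, do the following for increasing $i$: apply Algorithm 1 at $x_t$ (with any subgradient of $\tilde f$ at $x_t$) with $M=2^iM_t$,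 obtaining $(x^+_{t,i},\alpha_{t,i})$, and set $\nabla\tilde f(x^+_{t,i})=\nabla f(x^+_{t,i})+g_\psi(x^+_{t,i})$. If $\alpha_{t,i}=1$, pass to $i+1$. Otherwise, if $\|\nabla\tilde f(x^+_{t,i})\|\le\epsilon$, stop. Otherwise, if $$\tilde f(x_t)-\tilde f(x^+_{t,i})\ge\frac{1}{6(2^iM_t)^{1/3}}\|\nabla\tilde f(x^+_{t,i})\|^{4/3},$$ set $i_t=i$, $x_{t+1}=x^+_{t,i}$, $M_{t+1}=2^{i_t-1}M_t$ and go to iteration $t+1$; else pass to $i+1$. **Theorem 3.1.** Let $R_0\in(0,\infty)$ satisfy $\|x-x^*\|\le R_0$ for every $x$ with $\tilde f(x)\le\tilde f(x_0)$. Let $\epsilon>0$, and let $\{x_t\}_{t=0}^T$ be generated by Algorithm 2, through completed iterations $t=0,\dots,T-1$ whose trial points all satisfy $$\min\{\|\nabla\tilde f(x^+_{t,i})\|,\ \tilde f(x^+_{t,i})-\tilde f(x^*)\}\ge\epsilon .$$ Let $m$ be the first iteration number with $\tilde f(x_m)-\tilde f(x^*)\le6^3\cdot4\max\{2M_0,4L_f\}R_0^4$,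 and assume $T>m$. Then: 1. if $m>0$, $$m\le1+\frac1{\log_2(4/3)}\log_2\log_2\left(\frac{\tilde f(x_0)-\tilde f(x^*)}{6^3\max\{4M_0,8L_f\}R_0^4}\right);$$ 2. for all $k$ with $m<k\le T$, $$\tilde f(x_k)-\tilde f(x^*)\le\frac{42^3\max\{4M_0,8L_f\}R_0^4}{(k-m)^3};$$ 3. consequently, $T\le m+42\max\{4M_0,8L_f\}^{1/3}R_0^{4/3}\epsilon^{-1/3}$. -/

import Mathlib

namespace ThirdOrder

open Set

/-- `ℝⁿ` with the Euclidean norm. -/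
abbrev E (n : ℕ) := EuclideanSpace ℝ (Fin n)

noncomputable section

variable {n : ℕ}

/-! ### Extended-valued convex functions -/

/-- `ψ : ℝⁿ → ℝ ∪ {+∞}` is a convex function (the value `-∞` is excluded). -/
def ConvexExt (ψ : E n → EReal) : Prop :=
  (∀ x, ψ x ≠ ⊥) ∧
    ∀ x y : E n, ∀ a b : ℝ, 0 ≤ a → 0 ≤ b → a + b = 1 →
      ψ (a • x + b • y) ≤ (a : EReal) * ψ x + (b : EReal) * ψ y

/-- The effective domain `dom ψ`. -/
def effDom (ψ : E n → EReal) : Set (E n) := {x | ψ x < ⊤}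

/-- The composite objective `f̃ = f + ψ`. -/
def composite (f : E n → ℝ) (ψ : E n → EReal) (x : E n) : EReal := (f x : EReal) + ψ x

/-- The difference `f̃(x) - f̃(y)` as a real number, for `x, y ∈ dom ψ`. -/
def gap (f : E n → ℝ) (ψ : E n → EReal) (x y : E n) : ℝ :=
  (composite f ψ x).toReal - (composite f ψ y).toReal

/-- The subdifferential `∂h(x)` of a proper extended-valued function. -/
def subdiff (h : E n → EReal) (x : E n) : Set (E n) :=
  {g | ∀ y, h x + ((inner ℝ g (y - x) : ℝ) : EReal) ≤ h y}

/-! ### Derivatives, the third-order model and the Bregman distance -/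

/-- The Hessian `∇²f(x)` as a linear operator. -/
def hess (f : E n → ℝ) (x : E n) : E n →L[ℝ] E n := fderiv ℝ (gradient f) x

/-- `trace (∇²f(x))`. -/
def hessTrace (f : E n → ℝ) (x : E n) : ℝ :=
  LinearMap.trace ℝ (E n) (hess f x : E n →ₗ[ℝ] E n)

/-- Third-order Taylor polynomial
`Φ_x(y) = f(x) + ∑_{i=1}^{3} (1/i!) Dⁱf(x)[y-x]ⁱ`. -/
def taylor3 (f : E n → ℝ) (x y : E n) : ℝ :=
  f x + ∑ i ∈ Finset.Icc 1 3,
    (1 / (Nat.factorial i : ℝ)) * iteratedFDeriv ℝ i f x (fun _ => y - x)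

/-- `d₄(x) = ‖x‖⁴ / 4`. -/
def d4 (x : E n) : ℝ := (1 / 4) * ‖x‖ ^ 4

/-- Smooth part of the model, `Ω_{x,M}(y) = Φ_x(y) + (M/2) d₄(y-x)`. -/
def Omega (f : E n → ℝ) (x : E n) (M : ℝ) (y : E n) : ℝ :=
  taylor3 f x y + M / 2 * d4 (y - x)

/-- Scaling function `ρ_x(y) = ½⟨∇²f(x)(y-x), y-x⟩ + (M/2) d₄(y-x)`. -/
def rho (f : E n → ℝ) (x : E n) (M : ℝ) (y : E n) : ℝ :=
  (1 / 2) * inner ℝ (hess f x (y - x)) (y - x) + M / 2 * d4 (y - x)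

/-- Bregman distance `β_ρ(u,v) = ρ(v) - ρ(u) - ⟨∇ρ(u), v-u⟩`. -/
def bregman (ρ : E n → ℝ) (u v : E n) : ℝ :=
  ρ v - ρ u - inner ℝ (gradient ρ u) (v - u)

/-! ### Algorithm 1: the inner Bregman gradient method -/

/-- `L_{x,M}`, where `G` is the given subgradient `∇f̃(x)`. -/
def Lconst (f : E n → ℝ) (x G : E n) (M : ℝ) : ℝ :=
  hessTrace f x + 3 * M / 2 * (96 * ‖G‖ / M) ^ (2 / 3 : ℝ)

/-- `β_{x,M}`, where `G` is the given subgradient `∇f̃(x)`. -/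
def betaConst (f : E n → ℝ) (x G : E n) (M : ℝ) : ℝ :=
  (1 / 2) * hessTrace f x * (96 * ‖G‖ / M) ^ (2 / 3 : ℝ)
    + M / 8 * (96 * ‖G‖ / M) ^ (4 / 3 : ℝ)

/-- The function minimized over `y` in a Bregman gradient step from `u`:
`⟨∇Ω_{x,M}(u), y-u⟩ + 3 β_{ρ_x}(u,y) + ψ(y)`. -/
def stepObj (f : E n → ℝ) (ψ : E n → EReal) (x : E n) (M : ℝ) (u y : E n) : EReal :=
  ((inner ℝ (gradient (Omega f x M) u) (y - u) + 3 * bregman (rho f x M) u y : ℝ) : EReal) + ψ y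

/-- `v` is a result of a Bregman gradient step from `u`. -/
def IsStep (f : E n → ℝ) (ψ : E n → EReal) (x : E n) (M : ℝ) (u v : E n) : Prop :=
  ∀ y, stepObj f ψ x M u v ≤ stepObj f ψ x M u y

/-- `g_ψ(v) = -∇Ω_{x,M}(u) + 3[∇ρ_x(u) - ∇ρ_x(v)]` for a step from `u` to `v`. -/
def gPsi (f : E n → ℝ) (x : E n) (M : ℝ) (u v : E n) : E n :=
  -gradient (Omega f x M) u + (3 : ℝ) • (gradient (rho f x M) u - gradient (rho f x M) v)

/-- `‖∇Ω_{x,M}(v) + g_ψ(v)‖` for a step from `u` to `v`. -/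
def residual (f : E n → ℝ) (x : E n) (M : ℝ) (u v : E n) : ℝ :=
  ‖gradient (Omega f x M) v + gPsi f x M u v‖

/-- Stopping test of Step 2 (success) for a step from `u` to `v`. -/
def StopSuccess (f : E n → ℝ) (x : E n) (M ε : ℝ) (u v : E n) : Prop :=
  residual f x M u v ≤ ε / 7 ∨ residual f x M u v ≤ M / 6 * ‖v - x‖ ^ 3

/-- Stopping test of Step 3 (slow convergence) at inner iteration `k`, for a step from `u`
to `v`. -/
def StopSlow (f : E n → ℝ) (x G : E n) (M : ℝ) (k : ℕ) (u v : E n) : Prop :=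
  3 ^ 8 * Lconst f x G M ^ 4 * betaConst f x G M / (2 * M * (6 / 5) ^ k) < residual f x M u v ^ 4

/-- Algorithm 1, started at `x` with subgradient `G ∈ ∂f̃(x)`, regularization parameter `M` and
tolerance `ε`, terminates and outputs the pair `(xp, α)`; `gp` is the vector `g_ψ(xp)` that it
computed along with `xp`. The value `α = 1` is represented by `true`, `α = 0` by `false`.
The witnesses are the inner iterates `y` and the index `K` of the last inner iteration. -/
def Alg1Output (f : E n → ℝ) (ψ : E n → EReal) (ε : ℝ) (x G : E n) (M : ℝ)
    (xp gp : E n) (α : Bool) : Prop :=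
  x ∈ effDom ψ ∧ G ∈ subdiff (composite f ψ) x ∧
  ∃ (y : ℕ → E n) (K : ℕ),
    y 0 = x ∧
    (∀ k ≤ K, IsStep f ψ x M (y k) (y (k + 1))) ∧
    (∀ k < K, ¬ StopSuccess f x M ε (y k) (y (k + 1)) ∧
      ¬ StopSlow f x G M k (y k) (y (k + 1))) ∧
    xp = y (K + 1) ∧
    gp = gPsi f x M (y K) (y (K + 1)) ∧
    ((StopSuccess f x M ε (y K) (y (K + 1)) ∧ α = false) ∨
      (¬ StopSuccess f x M ε (y K) (y (K + 1)) ∧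
        StopSlow f x G M K (y K) (y (K + 1)) ∧ α = true))

/-! ### Algorithm 2: the basic adaptive third-order method -/

/-- The acceptance test `f̃(x) - f̃(xp) ≥ ‖g‖^{4/3} / (6 M^{1/3})`, where `g = ∇f̃(xp)`. -/
def Accept (f : E n → ℝ) (ψ : E n → EReal) (x : E n) (M : ℝ) (xp g : E n) : Prop :=
  1 / (6 * M ^ (1 / 3 : ℝ)) * ‖g‖ ^ (4 / 3 : ℝ) ≤ gap f ψ x xp

/-- A run of Algorithm 2 with parameters `M₀, ε` whose outer iterations `t = 0, …, T-1` have all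
been completed through Step 2, so that `x₀, …, x_T` have been generated. In iteration `t` the
trials `i = istart t, …, iacc t` are executed and the last one is accepted (`iacc t` is `i_t`).
Each execution of Algorithm 1 may use any subgradient of `f̃` at `x_t`. -/
structure Alg2Run (f : E n → ℝ) (ψ : E n → EReal) (M₀ ε : ℝ) (T : ℕ) where
  /-- outer iterates `x_t` -/
  x : ℕ → E n
  /-- regularization estimates `M_t` -/
  M : ℕ → ℝ
  /-- index of the first trial of iteration `t` -/
  istart : ℕ → ℕ
  /-- index `i_t` of the accepted trial of iteration `t` -/
  iacc : ℕ → ℕ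
  /-- trial points `x⁺_{t,i}` -/
  xp : ℕ → ℕ → E n
  /-- subgradients `g_ψ(x⁺_{t,i})` -/
  gp : ℕ → ℕ → E n
  /-- flags `α_{t,i}` -/
  α : ℕ → ℕ → Bool
  x_zero_mem : x 0 ∈ effDom ψ
  M_zero : M 0 = M₀
  istart_least : ∀ t < T, IsLeast {i : ℕ | 2 * M₀ ≤ 2 ^ i * M t} (istart t)
  istart_le : ∀ t < T, istart t ≤ iacc t
  inner : ∀ t < T, ∀ i ∈ Icc (istart t) (iacc t),
    ∃ G, Alg1Output f ψ ε (x t) G (2 ^ i * M t) (xp t i) (gp t i) (α t i)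
  /-- a trial before the last one is rejected: either `α = 1`, or `α = 0`, the method does not
  stop there, and the acceptance test fails -/
  rejected : ∀ t < T, ∀ i, istart t ≤ i → i < iacc t →
    α t i = true ∨
      (α t i = false ∧ ε < ‖gradient f (xp t i) + gp t i‖ ∧
        ¬ Accept f ψ (x t) (2 ^ i * M t) (xp t i) (gradient f (xp t i) + gp t i))
  accepted : ∀ t < T,
    α t (iacc t) = false ∧ ε < ‖gradient f (xp t (iacc t)) + gp t (iacc t)‖ ∧
      Accept f ψ (x t) (2 ^ iacc t * M t) (xp t (iacc t))
        (gradient f (xp t (iacc t)) + gp t (iacc t))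
  x_succ : ∀ t < T, x (t + 1) = xp t (iacc t)
  /-- `M_{t+1} = 2^{i_t - 1} M_t` -/
  M_succ : ∀ t < T, M (t + 1) = 2 ^ iacc t * M t / 2

end

end ThirdOrder

namespace ThirdOrder

/-! ### Real sequences with `u (k + 1) ^ (4 / 3) ≤ u k - u (k + 1)` -/

/-! Put N = max{4M₀, 8L_f}. The gaps f̃(x_k) - f̃(x*), divided by 6³NR₀⁴, form a sequence with
u_{k+1}^{4/3} ≤ u_k - u_{k+1} (`Alg2Run.gap_step`), and all three bounds are facts about such
sequences. While u exceeds 2, log u shrinks at least by the factor 3/4 per step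
(`doubly_log_bound`). Once u ≤ 2, u^{-1/3} grows by at least 1/7 per step (`cubic_decay`). The
constant 42 is 6·7.

The recursion combines the acceptance test with the subgradient inequality δ_{k+1} ≤ ‖g‖R₀; it needs
accepted parameters to stay below N (`Alg2Run.accepted_le`). This holds because no trial with M ≥
4L_f is rejected: the inner method does not report slow convergence (`not_stopSlow`), and a
successful inner run passes the acceptance test (`accept_of_stopSuccess`).

For the inner method, nonnegativity of the Hessian at x + 2h bounds the third derivative by the
Hessian (`third_le`). Hence the Bregman distance of Ω lies between 1/2 and 3/2 times that of ρ
(`abs_bregman_omega_sub_le`). A step with weight 3 then contracts the ρ-distance to any point of no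
larger model value by 5/6 (`IsStep.model_sub_le`). The bounds β_ρ ≥ (M/32)‖v-u‖⁴ and residual ≤
const·‖v-u‖ turn this into decay of the residual. -/

lemma le_of_pow_three_le {a b : ℝ} (hb : 0 ≤ b) (h : a ^ 3 ≤ b ^ 3) : a ≤ b :=
  le_of_pow_le_pow_left₀ (by norm_num) hb h

lemma rpow_third_pow_three {a : ℝ} (ha : 0 ≤ a) : (a ^ (1 / 3 : ℝ)) ^ 3 = a := by
  rw [← Real.rpow_natCast, ← Real.rpow_mul ha]; norm_num

lemma rpow_four_thirds {a : ℝ} (ha : 0 ≤ a) : a ^ (4 / 3 : ℝ) = (a ^ (1 / 3 : ℝ)) ^ 4 := by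
  rw [← Real.rpow_natCast, ← Real.rpow_mul ha]; norm_num

lemma rpow_two_thirds {a : ℝ} (ha : 0 ≤ a) : a ^ (2 / 3 : ℝ) = (a ^ (1 / 3 : ℝ)) ^ 2 := by
  rw [← Real.rpow_natCast, ← Real.rpow_mul ha]; norm_num

/-- With a = s³ and b = p³ the hypothesis is s³(1+s) ≤ p³, and b ≤ 2 forces s ≤ 1. The conclusion is
7s ≤ p(7-s); after cubing it follows from (1+s)(7-s)³ ≥ 343 on [0,1]. -/
lemma inv_cbrt_step {a b : ℝ} (ha : 0 < a) (hb : b ≤ 2) (h : a ^ (4 / 3 : ℝ) ≤ b - a) :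
    (b ^ (1 / 3 : ℝ))⁻¹ + 1 / 7 ≤ (a ^ (1 / 3 : ℝ))⁻¹ := by
  have hb0 : 0 < b := by
    have := Real.rpow_pos_of_pos ha (4 / 3 : ℝ)
    linarith
  rw [rpow_four_thirds ha.le] at h
  have hs : 0 < a ^ (1 / 3 : ℝ) := Real.rpow_pos_of_pos ha _
  have hp : 0 < b ^ (1 / 3 : ℝ) := Real.rpow_pos_of_pos hb0 _
  have hs3 := rpow_third_pow_three ha.le
  have hp3 := rpow_third_pow_three hb0.le
  set s := a ^ (1 / 3 : ℝ)
  set p := b ^ (1 / 3 : ℝ)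
  have hs1 : s ≤ 1 := by
    by_contra! hc
    have h3 : 1 < s ^ 3 := one_lt_pow₀ hc (by norm_num)
    have h4 : 1 < s ^ 4 := one_lt_pow₀ hc (by norm_num)
    linarith
  have key : 7 * s ≤ p * (7 - s) := by
    apply le_of_pow_three_le (by nlinarith)
    have h1 : s ^ 3 + s ^ 4 ≤ p ^ 3 := by linarith
    have h2 : 0 ≤ (7 - s) ^ 3 := by
      have : 0 ≤ 7 - s := by linarith
      positivity
    have h3 : 343 ≤ (1 + s) * (7 - s) ^ 3 := by
      have h4 : 0 ≤ (1 - s) * s ^ 2 := mul_nonneg (by linarith) (by positivity)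
      have h5 : 0 ≤ (1 - s) * s ^ 3 := mul_nonneg (by linarith) (by positivity)
      have h6 : 0 ≤ (1 - s) * s := mul_nonneg (by linarith) hs.le
      nlinarith
    calc (7 * s) ^ 3 = s ^ 3 * 343 := by ring
      _ ≤ s ^ 3 * ((1 + s) * (7 - s) ^ 3) := by gcongr
      _ = (s ^ 3 + s ^ 4) * (7 - s) ^ 3 := by ring
      _ ≤ p ^ 3 * (7 - s) ^ 3 := by gcongr
      _ = _ := by ring
  rw [← sub_nonneg]
  have : s⁻¹ - (p⁻¹ + 1 / 7) = (p * (7 - s) - 7 * s) / (7 * s * p) := by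
    field_simp; ring
  rw [this]
  exact div_nonneg (by linarith) (by positivity)

/-- Telescoping `inv_cbrt_step` from index m gives u_k^{-1/3} ≥ (k-m)/7; the term u_m^{-1/3} is
dropped as nonnegative. -/
lemma cubic_decay {u : ℕ → ℝ} {m T : ℕ} (hpos : ∀ k, m < k → k ≤ T → 0 < u k)
    (hm : u m ≤ 2) (hstep : ∀ k < T, m ≤ k → u (k + 1) ^ (4 / 3 : ℝ) ≤ u k - u (k + 1))
    {k : ℕ} (hmk : m < k) (hkT : k ≤ T) : u k ≤ 7 ^ 3 / ((k : ℝ) - m) ^ 3 := by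
  have key : ∀ j : ℕ, m + 1 + j ≤ T →
      u (m + 1 + j) ≤ 2 ∧ ((j : ℝ) + 1) / 7 ≤ (u (m + 1 + j) ^ (1 / 3 : ℝ))⁻¹ := by
    have one : ∀ k, m ≤ k → k + 1 ≤ T → u k ≤ 2 → u (k + 1) ≤ 2 ∧
        (u k ^ (1 / 3 : ℝ))⁻¹ + 1 / 7 ≤ (u (k + 1) ^ (1 / 3 : ℝ))⁻¹ := by
      intro k hk hkT h2
      have hp := hpos (k + 1) (by omega) hkT
      have hst := hstep k (by omega) hk
      have := Real.rpow_pos_of_pos hp (4 / 3 : ℝ)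
      exact ⟨by linarith, inv_cbrt_step hp h2 hst⟩
    intro j
    induction j with
    | zero =>
      intro hT
      obtain ⟨h1, h2⟩ := one m le_rfl hT hm
      refine ⟨h1, ?_⟩
      have hp := hpos (m + 1) (by omega) hT
      have hst := hstep m (by omega) le_rfl
      have h3 := Real.rpow_pos_of_pos hp (4 / 3 : ℝ)
      have : 0 ≤ (u m ^ (1 / 3 : ℝ))⁻¹ := by
        have : 0 ≤ u m := by linarith
        positivity
      simp only [add_zero, Nat.cast_zero, zero_add]
      linarith
    | succ j ih =>
      intro hT
      obtain ⟨h1, h2⟩ := ih (by omega)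
      obtain ⟨h3, h4⟩ := one (m + 1 + j) (by omega) (by omega) h1
      refine ⟨h3, ?_⟩
      push_cast
      rw [← add_assoc (m + 1)]
      linarith
  obtain ⟨j, rfl⟩ : ∃ j, k = m + 1 + j := ⟨k - (m + 1), by omega⟩
  have hp := hpos _ hmk hkT
  obtain ⟨-, h⟩ := key j hkT
  have hs := Real.rpow_pos_of_pos hp (1 / 3 : ℝ)
  rw [← rpow_third_pow_three hp.le]
  have e : ((m + 1 + j : ℕ) : ℝ) - m = j + 1 := by push_cast; ring
  rw [e, ← div_pow]
  gcongr
  rw [le_div_iff₀ (by positivity)]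
  rw [inv_eq_one_div, div_le_div_iff₀ (by norm_num) hs] at h
  linarith

/-- Since u_{k+1}^{4/3} ≤ u_k, going backwards from N multiplies log₂ u by at least 4/3 per step. It
starts above log₂ 2 = 1, so (4/3)^N ≤ log₂ u₀. -/
lemma doubly_log_bound {u : ℕ → ℝ} {N : ℕ} (hN : 2 < u N)
    (hstep : ∀ k < N, u (k + 1) ^ (4 / 3 : ℝ) ≤ u k - u (k + 1)) :
    (N : ℝ) ≤ 1 / Real.logb 2 (4 / 3) * Real.logb 2 (Real.logb 2 (u 0)) := by
  have key : ∀ j ≤ N, 2 < u (N - j) ∧ (4 / 3 : ℝ) ^ j ≤ Real.logb 2 (u (N - j)) := by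
    intro j
    induction j with
    | zero =>
      intro _
      refine ⟨hN, ?_⟩
      rw [pow_zero, Real.le_logb_iff_rpow_le (by norm_num) (by simpa using by linarith)]
      simpa using hN.le
    | succ j ih =>
      intro hj
      obtain ⟨h1, h2⟩ := ih (by omega)
      have hst := hstep (N - (j + 1)) (by omega)
      rw [show N - (j + 1) + 1 = N - j by omega] at hst
      have h0 : 0 < u (N - j) := by linarith
      have h3 := Real.rpow_pos_of_pos h0 (4 / 3 : ℝ)
      refine ⟨by linarith, ?_⟩
      calc (4 / 3 : ℝ) ^ (j + 1) = 4 / 3 * (4 / 3) ^ j := by ring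
        _ ≤ 4 / 3 * Real.logb 2 (u (N - j)) := by gcongr
        _ = Real.logb 2 (u (N - j) ^ (4 / 3 : ℝ)) := by rw [Real.logb_rpow_eq_mul_logb_of_pos h0]
        _ ≤ _ := Real.logb_le_logb_of_le (by norm_num) h3 (by linarith)
  obtain ⟨-, h⟩ := key N le_rfl
  rw [Nat.sub_self] at h
  have hl : 0 < Real.logb 2 (4 / 3) := Real.logb_pos (by norm_num) (by norm_num)
  have h2 := Real.logb_le_logb_of_le (b := 2) (by norm_num) (by positivity) h
  rw [Real.logb_pow] at h2
  rw [one_div, inv_mul_eq_div, le_div_iff₀ hl]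
  exact h2

/-! ### Second and third derivatives of a convex function with Lipschitz third derivative -/

section Calculus

variable {F G : Type*} [NormedAddCommGroup F] [NormedSpace ℝ F]
  [NormedAddCommGroup G] [NormedSpace ℝ G]

lemma hasDerivAt_comp_line {g : F → G} (hg : Differentiable ℝ g) (x h : F) (t : ℝ) :
    HasDerivAt (fun s : ℝ => g (x + s • h)) (fderiv ℝ g (x + t • h) h) t := by
  have h1 : HasDerivAt (fun s : ℝ => x + s • h) h t := by
    simpa using ((hasDerivAt_id t).smul_const h).const_add x
  exact (hg (x + t • h)).hasFDerivAt.comp_hasDerivAt t h1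

/-- Comparison of a curve on `[0, ∞)` with a monomial through its derivative. -/
lemma norm_le_of_norm_deriv_le_pow {g g' : ℝ → G} {K : ℝ} {p : ℕ} (h0 : g 0 = 0)
    (hg : ∀ t, HasDerivAt g (g' t) t) (hb : ∀ t, 0 ≤ t → ‖g' t‖ ≤ K * t ^ p) {t : ℝ}
    (ht : 0 ≤ t) : ‖g t‖ ≤ K / (p + 1) * t ^ (p + 1) := by
  refine image_norm_le_of_norm_deriv_right_le_deriv_boundary (a := 0) (b := t) (f' := g')
    (B := fun t => K / (p + 1) * t ^ (p + 1)) (B' := fun t => K * t ^ p)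
    (fun s _ => (hg s).continuousAt.continuousWithinAt)
    (fun s _ => (hg s).hasDerivWithinAt) (by simp [h0]) (fun s => ?_)
    (fun s hs => hb s hs.1) ⟨ht, le_rfl⟩
  have := (hasDerivAt_pow (p + 1) s).const_mul (K / (p + 1))
  have hp : (p : ℝ) + 1 ≠ 0 := by positivity
  rw [← mul_assoc, Nat.cast_add, Nat.cast_one, div_mul_cancel₀ _ hp] at this
  exact this

lemma taylor_one_le {g g' : ℝ → ℝ} {K : ℝ} (hg : ∀ t, HasDerivAt g (g' t) t)
    (hb : ∀ t, 0 ≤ t → |g' t - g' 0| ≤ K * t) {t : ℝ} (ht : 0 ≤ t) :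
    |g t - g 0 - t * g' 0| ≤ K / 2 * t ^ 2 := by
  have h : ∀ t, HasDerivAt (fun t => g t - g 0 - t * g' 0) (g' t - g' 0) t := fun t => by
    simpa using ((hg t).sub_const (g 0)).fun_sub ((hasDerivAt_id t).mul_const (g' 0))
  have := norm_le_of_norm_deriv_le_pow (p := 1) (K := K) (by simp) h
    (fun t ht => by simpa using hb t ht) ht
  norm_num at this
  exact this

lemma taylor_two_le {g g' g'' : ℝ → ℝ} {K : ℝ} (hg : ∀ t, HasDerivAt g (g' t) t)
    (hg' : ∀ t, HasDerivAt g' (g'' t) t)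
    (hb : ∀ t, 0 ≤ t → |g'' t - g'' 0| ≤ K * t) {t : ℝ} (ht : 0 ≤ t) :
    |g t - g 0 - t * g' 0 - t ^ 2 * (1 / 2 * g'' 0)| ≤ K / 6 * t ^ 3 := by
  have h : ∀ t, HasDerivAt (fun t => g t - g 0 - t * g' 0 - t ^ 2 * (1 / 2 * g'' 0))
      (g' t - g' 0 - t * g'' 0) t := fun t => by
    have := (((hg t).sub_const (g 0)).fun_sub ((hasDerivAt_id t).mul_const (g' 0))).fun_sub
      ((hasDerivAt_pow 2 t).mul_const (1 / 2 * g'' 0))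
    refine this.congr_deriv ?_
    norm_num
    ring
  have := norm_le_of_norm_deriv_le_pow (p := 2) (K := K / 2) (by simp) h
    (fun t ht => taylor_one_le hg' hb ht) ht
  rw [Real.norm_eq_abs] at this
  refine this.trans (le_of_eq ?_)
  push_cast
  ring

end Calculus

variable {n : ℕ} {f : E n → ℝ}

lemma contDiff_fderiv (hf : ContDiff ℝ 3 f) : ContDiff ℝ 2 (fderiv ℝ f) :=
  hf.fderiv_right (by norm_num)

lemma contDiff_fderiv_fderiv (hf : ContDiff ℝ 3 f) : ContDiff ℝ 1 (fderiv ℝ (fderiv ℝ f)) :=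
  (contDiff_fderiv hf).fderiv_right (by norm_num)

lemma differentiable_snd_apply (hf : ContDiff ℝ 3 f) (b c : E n) :
    Differentiable ℝ (fun y => fderiv ℝ (fderiv ℝ f) y b c) := fun x =>
  ((((contDiff_fderiv_fderiv hf).differentiable (by norm_num) x).clm_apply
    (differentiableAt_const b)).clm_apply (differentiableAt_const c))

lemma fderiv_snd_apply (hf : ContDiff ℝ 3 f) (x a b c : E n) :
    fderiv ℝ (fun y => fderiv ℝ (fderiv ℝ f) y b c) x a =
      fderiv ℝ (fderiv ℝ (fderiv ℝ f)) x a b c := by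
  have h2 : Differentiable ℝ (fderiv ℝ (fderiv ℝ f)) :=
    (contDiff_fderiv_fderiv hf).differentiable (by norm_num)
  rw [(((h2 x).hasFDerivAt.clm_apply (hasFDerivAt_const b x)).clm_apply
    (hasFDerivAt_const c x)).fderiv]
  simp

lemma iteratedFDeriv_three_apply (hf : ContDiff ℝ 3 f) (x a b c : E n) :
    iteratedFDeriv ℝ 3 f x ![a, b, c] = fderiv ℝ (fderiv ℝ (fderiv ℝ f)) x a b c := by
  rw [iteratedFDeriv_succ_apply_left]
  have hd : DifferentiableAt ℝ (iteratedFDeriv ℝ 2 f) x :=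
    hf.differentiable_iteratedFDeriv (by norm_num) x
  have e1 : (fderiv ℝ (iteratedFDeriv ℝ 2 f) x a) ![b, c] =
      fderiv ℝ (fun y => iteratedFDeriv ℝ 2 f y ![b, c]) x a := by
    rw [fderiv_continuousMultilinear_apply_const_apply hd]
  have e3 : (fun y => iteratedFDeriv ℝ 2 f y ![b, c]) =
      fun y => fderiv ℝ (fderiv ℝ f) y b c := by
    funext y; rw [iteratedFDeriv_two_apply]; simp
  rw [← fderiv_snd_apply hf, ← e3, ← e1]
  rfl

lemma snd_symm (hf : ContDiff ℝ 3 f) (x a b : E n) :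
    fderiv ℝ (fderiv ℝ f) x a b = fderiv ℝ (fderiv ℝ f) x b a :=
  hf.contDiffAt.isSymmSndFDerivAt (by simp; norm_num) a b

lemma third_symm_left (hf : ContDiff ℝ 3 f) (x a b c : E n) :
    fderiv ℝ (fderiv ℝ (fderiv ℝ f)) x a b c = fderiv ℝ (fderiv ℝ (fderiv ℝ f)) x b a c :=
  DFunLike.congr_fun ((contDiff_fderiv hf).contDiffAt.isSymmSndFDerivAt (by simp) a b) c

lemma third_symm_right (hf : ContDiff ℝ 3 f) (x a b c : E n) :
    fderiv ℝ (fderiv ℝ (fderiv ℝ f)) x a b c = fderiv ℝ (fderiv ℝ (fderiv ℝ f)) x a c b := by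
  rw [← fderiv_snd_apply hf, ← fderiv_snd_apply hf]
  simp only [snd_symm hf _ b c]

lemma third_lipschitz (hf : ContDiff ℝ 3 f) {L : ℝ}
    (hL : ∀ x y, ‖iteratedFDeriv ℝ 3 f x - iteratedFDeriv ℝ 3 f y‖ ≤ L * ‖x - y‖)
    (x y a b c : E n) :
    |fderiv ℝ (fderiv ℝ (fderiv ℝ f)) x a b c - fderiv ℝ (fderiv ℝ (fderiv ℝ f)) y a b c| ≤
      L * ‖x - y‖ * (‖a‖ * ‖b‖ * ‖c‖) := by
  rw [← iteratedFDeriv_three_apply hf, ← iteratedFDeriv_three_apply hf,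
    ← _root_.sub_apply, ← Real.norm_eq_abs]
  refine (ContinuousMultilinearMap.le_opNorm _ _).trans ?_
  rw [Fin.prod_univ_three]
  exact mul_le_mul_of_nonneg_right (hL x y) (by positivity)

lemma fderiv_line_le (hc : ConvexOn ℝ Set.univ f) (hf : ContDiff ℝ 3 f) (x y : E n) :
    f x + fderiv ℝ f x (y - x) ≤ f y := by
  have hd : Differentiable ℝ f := hf.differentiable (by norm_num)
  have hl := hasDerivAt_comp_line hd x (y - x) 0
  have hcv : ConvexOn ℝ Set.univ (fun s : ℝ => f (x + s • (y - x))) := by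
    have e : (fun s : ℝ => f (x + s • (y - x))) = f ∘ AffineMap.lineMap x y := by
      funext s
      simp [AffineMap.lineMap_apply, add_comm]
    rw [e]
    exact hc.comp_affineMap (AffineMap.lineMap x y)
  have := hcv.le_slope_of_hasDerivAt (Set.mem_univ 0) (Set.mem_univ 1) one_pos hl
  simp only [slope_def_field, zero_smul, one_smul, add_zero, add_sub_cancel, sub_zero, div_one]
    at this
  linarith

lemma snd_nonneg (hc : ConvexOn ℝ Set.univ f) (hf : ContDiff ℝ 3 f) (x w : E n) :
    0 ≤ fderiv ℝ (fderiv ℝ f) x w w := by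
  have hd1 : Differentiable ℝ (fderiv ℝ f) := (contDiff_fderiv hf).differentiable (by norm_num)
  have h1 := (hasDerivAt_comp_line hd1 x w 0).clm_apply (hasDerivAt_const (0 : ℝ) w)
  have h1 := h1.deriv
  rw [zero_smul, add_zero, map_zero, add_zero] at h1
  rw [← h1]
  refine Monotone.deriv_nonneg ?_
  intro s t hst
  have a1 := fderiv_line_le hc hf (x + s • w) (x + t • w)
  have a2 := fderiv_line_le hc hf (x + t • w) (x + s • w)
  rw [show x + t • w - (x + s • w) = (t - s) • w by module, map_smul, smul_eq_mul] at a1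
  rw [show x + s • w - (x + t • w) = (s - t) • w by module, map_smul, smul_eq_mul] at a2
  rcases hst.eq_or_lt with rfl | hlt
  · exact le_rfl
  · have : 0 ≤ (t - s) * (fderiv ℝ f (x + t • w) w - fderiv ℝ f (x + s • w) w) := by linarith
    have := nonneg_of_mul_nonneg_right this (sub_pos.2 hlt)
    simpa using this

lemma hasDerivAt_fderiv_line (hf : ContDiff ℝ 3 f) (x h w : E n) (t : ℝ) :
    HasDerivAt (fun t : ℝ => fderiv ℝ f (x + t • h) w)
      (fderiv ℝ (fderiv ℝ f) (x + t • h) h w) t := by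
  have h1 : Differentiable ℝ (fderiv ℝ f) := (contDiff_fderiv hf).differentiable (by norm_num)
  simpa using (hasDerivAt_comp_line h1 x h t).clm_apply (hasDerivAt_const t w)

lemma hasDerivAt_snd_line (hf : ContDiff ℝ 3 f) (x h v w : E n) (t : ℝ) :
    HasDerivAt (fun t : ℝ => fderiv ℝ (fderiv ℝ f) (x + t • h) v w)
      (fderiv ℝ (fderiv ℝ (fderiv ℝ f)) (x + t • h) h v w) t :=
  (hasDerivAt_comp_line (differentiable_snd_apply hf v w) x h t).congr_deriv
    (fderiv_snd_apply hf _ _ _ _)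

lemma third_line_lipschitz (hf : ContDiff ℝ 3 f) {L : ℝ}
    (hL : ∀ x y, ‖iteratedFDeriv ℝ 3 f x - iteratedFDeriv ℝ 3 f y‖ ≤ L * ‖x - y‖)
    (x h v w : E n) {t : ℝ} (ht : 0 ≤ t) :
    |fderiv ℝ (fderiv ℝ (fderiv ℝ f)) (x + t • h) h v w
      - fderiv ℝ (fderiv ℝ (fderiv ℝ f)) x h v w| ≤ L * (‖h‖ ^ 2 * (‖v‖ * ‖w‖)) * t := by
  refine (third_lipschitz hf hL _ _ _ _ _).trans (le_of_eq ?_)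
  rw [add_sub_cancel_left, norm_smul, Real.norm_of_nonneg ht]
  ring

/-- Convexity and the Lipschitz condition on the third derivative bound the third derivative by
the Hessian. -/
lemma third_le (hc : ConvexOn ℝ Set.univ f) (hf : ContDiff ℝ 3 f) {L M : ℝ}
    (hL : ∀ x y, ‖iteratedFDeriv ℝ 3 f x - iteratedFDeriv ℝ 3 f y‖ ≤ L * ‖x - y‖)
    (hM : 4 * L ≤ M) (x h w : E n) :
    |fderiv ℝ (fderiv ℝ (fderiv ℝ f)) x h w w| ≤
      1 / 2 * fderiv ℝ (fderiv ℝ f) x w w + M / 4 * (‖h‖ ^ 2 * ‖w‖ ^ 2) := by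
  have main : ∀ h : E n, -fderiv ℝ (fderiv ℝ (fderiv ℝ f)) x h w w ≤
      1 / 2 * fderiv ℝ (fderiv ℝ f) x w w + M / 4 * (‖h‖ ^ 2 * ‖w‖ ^ 2) := by
    intro h
    -- The Hessian form at x + th is nonnegative, so -D³f[h,w,w] ≤ (1/t)D²f[w,w] + (t/2)L‖h‖²‖w‖².
    -- The choice t = 2 gives the coefficient 1/2, and L ≤ M/4 finishes.
    have := taylor_one_le (hasDerivAt_snd_line hf x h w w) (K := L * (‖h‖ ^ 2 * (‖w‖ * ‖w‖)))
      (fun t ht => by simpa using third_line_lipschitz hf hL x h w w ht) (t := 2) (by norm_num)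
    have h3 := (abs_le.1 this).2
    have h4 := snd_nonneg hc hf (x + (2 : ℝ) • h) w
    rw [zero_smul, add_zero] at h3
    have h5 : 4 * L * (‖h‖ ^ 2 * ‖w‖ ^ 2) ≤ M * (‖h‖ ^ 2 * ‖w‖ ^ 2) := by gcongr
    linarith
  rw [abs_le']
  refine ⟨?_, main h⟩
  have := main (-h)
  simpa using this

/-- Second-order Taylor bound for the derivative of `f`. -/
lemma fderiv_taylor (hf : ContDiff ℝ 3 f) {L : ℝ}
    (hL : ∀ x y, ‖iteratedFDeriv ℝ 3 f x - iteratedFDeriv ℝ 3 f y‖ ≤ L * ‖x - y‖)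
    (x h w : E n) :
    |fderiv ℝ f (x + h) w - (fderiv ℝ f x w + fderiv ℝ (fderiv ℝ f) x h w
      + 1 / 2 * fderiv ℝ (fderiv ℝ (fderiv ℝ f)) x h h w)| ≤ L / 6 * ‖h‖ ^ 3 * ‖w‖ := by
  have := taylor_two_le (hasDerivAt_fderiv_line hf x h w) (hasDerivAt_snd_line hf x h h w)
    (K := L * (‖h‖ ^ 2 * (‖h‖ * ‖w‖)))
    (fun t ht => by simpa using third_line_lipschitz hf hL x h h w ht) (t := 1) zero_le_one
  simp only [zero_smul, add_zero, one_smul] at this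
  refine le_trans (le_of_eq ?_) (this.trans (le_of_eq ?_))
  · congr 1; ring
  · ring

/-! ### The model `Ω`, the scaling function `ρ` and their Bregman distances -/

/-- The second derivative of `f` at `x` as a bilinear form. -/
noncomputable abbrev D2 (f : E n → ℝ) (x : E n) : E n →L[ℝ] E n →L[ℝ] ℝ :=
  fderiv ℝ (fderiv ℝ f) x

/-- The third derivative of `f` at `x` as a trilinear form. -/
noncomputable abbrev D3 (f : E n → ℝ) (x : E n) : E n →L[ℝ] E n →L[ℝ] E n →L[ℝ] ℝ :=
  fderiv ℝ (fderiv ℝ (fderiv ℝ f)) x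

lemma inner_hess (hf : ContDiff ℝ 3 f) (x a b : E n) :
    inner ℝ (hess f x a) b = D2 f x a b := by
  have hg : DifferentiableAt ℝ (gradient f) x := by
    have : ContDiff ℝ 2 (gradient f) :=
      (InnerProductSpace.toDual ℝ (E n)).symm.toContinuousLinearEquiv.contDiff.comp
        (contDiff_fderiv hf)
    exact this.differentiable (by norm_num) x
  have h1 : Differentiable ℝ (fderiv ℝ f) := (contDiff_fderiv hf).differentiable (by norm_num)
  have e : (fun y => inner ℝ (gradient f y) b) = fun y => fderiv ℝ f y b := by
    funext y; exact inner_gradient_left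
  have e1 := fderiv_inner_apply ℝ hg (differentiableAt_const b) a
  rw [e, ((h1 x).hasFDerivAt.clm_apply (hasFDerivAt_const b x)).fderiv] at e1
  simp at e1
  exact e1.symm

lemma taylor3_eq (hf : ContDiff ℝ 3 f) (x y : E n) :
    taylor3 f x y = f x + fderiv ℝ f x (y - x) + 1 / 2 * D2 f x (y - x) (y - x)
      + 1 / 6 * D3 f x (y - x) (y - x) (y - x) := by
  have h3 := iteratedFDeriv_three_apply hf x (y - x) (y - x) (y - x)
  have e : (fun _ : Fin 3 => y - x) = ![y - x, y - x, y - x] := by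
    funext i; fin_cases i <;> rfl
  rw [taylor3, show Finset.Icc 1 3 = {1, 2, 3} by rfl]
  rw [Finset.sum_insert (by simp), Finset.sum_insert (by simp), Finset.sum_singleton,
    iteratedFDeriv_one_apply, iteratedFDeriv_two_apply, e, h3]
  norm_num [Nat.factorial]
  ring

lemma omega_eq (hf : ContDiff ℝ 3 f) (x y : E n) (M : ℝ) :
    Omega f x M y = f x + fderiv ℝ f x (y - x) + 1 / 2 * D2 f x (y - x) (y - x)
      + 1 / 6 * D3 f x (y - x) (y - x) (y - x) + M / 8 * (‖y - x‖ ^ 2) ^ 2 := by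
  rw [Omega, taylor3_eq hf, d4]; ring

lemma rho_eq (hf : ContDiff ℝ 3 f) (x y : E n) (M : ℝ) :
    rho f x M y = 1 / 2 * D2 f x (y - x) (y - x) + M / 8 * (‖y - x‖ ^ 2) ^ 2 := by
  rw [rho, inner_hess hf, d4]; ring

lemma norm_add_smul_sq (a b : E n) (t : ℝ) :
    ‖a + t • b‖ ^ 2 = ‖a‖ ^ 2 + 2 * t * inner ℝ a b + t ^ 2 * ‖b‖ ^ 2 := by
  rw [norm_add_sq_real, real_inner_smul_right, norm_smul, mul_pow, Real.norm_eq_abs, sq_abs]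
  ring

/-- Along a line ρ is a quartic in t, as is Ω below. The coefficient of t is the directional
derivative, and the remaining coefficients sum at t = 1 to the Bregman distance, so both can be read
off without differentiating the norm. -/
lemma rho_line (hf : ContDiff ℝ 3 f) (x u w : E n) (M t : ℝ) :
    rho f x M (u + t • w) = rho f x M u
      + t * (D2 f x (u - x) w + M / 2 * (‖u - x‖ ^ 2 * inner ℝ (u - x) w))
      + t ^ 2 * (1 / 2 * D2 f x w w
        + M / 2 * (inner ℝ (u - x) w ^ 2 + ‖u - x‖ ^ 2 * ‖w‖ ^ 2 / 2))
      + t ^ 3 * (M / 2 * (inner ℝ (u - x) w * ‖w‖ ^ 2))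
      + t ^ 4 * (M / 8 * (‖w‖ ^ 2) ^ 2) := by
  have e : u + t • w - x = (u - x) + t • w := by abel
  rw [rho_eq hf, rho_eq hf, e, norm_add_smul_sq]
  simp only [map_add, map_smul, _root_.add_apply, _root_.smul_apply,
    smul_eq_mul, snd_symm hf x w (u - x)]
  ring

lemma omega_line (hf : ContDiff ℝ 3 f) (x u w : E n) (M t : ℝ) :
    Omega f x M (u + t • w) = Omega f x M u
      + t * (fderiv ℝ f x w + D2 f x (u - x) w + 1 / 2 * D3 f x (u - x) (u - x) w
        + M / 2 * (‖u - x‖ ^ 2 * inner ℝ (u - x) w))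
      + t ^ 2 * (1 / 2 * D2 f x w w + 1 / 2 * D3 f x (u - x) w w
        + M / 2 * (inner ℝ (u - x) w ^ 2 + ‖u - x‖ ^ 2 * ‖w‖ ^ 2 / 2))
      + t ^ 3 * (1 / 6 * D3 f x w w w + M / 2 * (inner ℝ (u - x) w * ‖w‖ ^ 2))
      + t ^ 4 * (M / 8 * (‖w‖ ^ 2) ^ 2) := by
  have e : u + t • w - x = (u - x) + t • w := by abel
  rw [omega_eq hf, omega_eq hf, e, norm_add_smul_sq]
  simp only [map_add, map_smul, _root_.add_apply, _root_.smul_apply,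
    smul_eq_mul, snd_symm hf x w (u - x)]
  rw [third_symm_left hf x w (u - x) (u - x), third_symm_left hf x w (u - x) w,
    third_symm_right hf x (u - x) w (u - x), third_symm_right hf x w w (u - x),
    third_symm_left hf x w (u - x) w]
  ring

lemma differentiable_rho (hf : ContDiff ℝ 3 f) (x : E n) (M : ℝ) :
    Differentiable ℝ (rho f x M) := by
  have e : rho f x M = fun y =>
      1 / 2 * D2 f x (y - x) (y - x) + M / 8 * (‖y - x‖ ^ 2) ^ 2 := by
    funext y; exact rho_eq hf x y M
  rw [e]
  have h : Differentiable ℝ (fun y : E n => y - x) := by fun_prop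
  have h1 : Differentiable ℝ (fun y : E n => ‖y - x‖ ^ 2) := h.norm_sq ℝ
  have h2 : Differentiable ℝ (fun y : E n => D2 f x (y - x) (y - x)) :=
    ((D2 f x).differentiable.comp h).clm_apply h
  fun_prop

lemma differentiable_omega (hf : ContDiff ℝ 3 f) (x : E n) (M : ℝ) :
    Differentiable ℝ (Omega f x M) := by
  have e : Omega f x M = fun y => f x + fderiv ℝ f x (y - x) + 1 / 2 * D2 f x (y - x) (y - x)
      + 1 / 6 * D3 f x (y - x) (y - x) (y - x) + M / 8 * (‖y - x‖ ^ 2) ^ 2 := by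
    funext y; exact omega_eq hf x y M
  rw [e]
  have h : Differentiable ℝ (fun y : E n => y - x) := by fun_prop
  have h1 : Differentiable ℝ (fun y : E n => ‖y - x‖ ^ 2) := h.norm_sq ℝ
  have h2 : Differentiable ℝ (fun y : E n => D2 f x (y - x) (y - x)) :=
    ((D2 f x).differentiable.comp h).clm_apply h
  have h3 : Differentiable ℝ (fun y : E n => D3 f x (y - x) (y - x) (y - x)) := by fun_prop
  fun_prop

lemma inner_gradient_of_line {g : E n → ℝ} (hg : Differentiable ℝ g) {u w : E n}
    {c₁ c₂ c₃ c₄ : ℝ}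
    (h : ∀ t : ℝ, g (u + t • w) = g u + t * c₁ + t ^ 2 * c₂ + t ^ 3 * c₃ + t ^ 4 * c₄) :
    inner ℝ (gradient g u) w = c₁ := by
  rw [inner_gradient_left]
  have h1 := hasDerivAt_comp_line hg u w 0
  rw [zero_smul, add_zero] at h1
  have h2 : HasDerivAt
      (fun t : ℝ => g u + t * c₁ + t ^ 2 * c₂ + t ^ 3 * c₃ + t ^ 4 * c₄) c₁ 0 := by
    have := (((((hasDerivAt_id (0 : ℝ)).mul_const c₁).const_add (g u)).fun_add
      ((hasDerivAt_pow 2 (0 : ℝ)).mul_const c₂)).fun_add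
      ((hasDerivAt_pow 3 (0 : ℝ)).mul_const c₃)).fun_add
      ((hasDerivAt_pow 4 (0 : ℝ)).mul_const c₄)
    refine this.congr_deriv ?_
    norm_num
  rw [funext h] at h1
  exact h1.unique h2

lemma inner_gradient_rho (hf : ContDiff ℝ 3 f) (x u w : E n) (M : ℝ) :
    inner ℝ (gradient (rho f x M) u) w =
      D2 f x (u - x) w + M / 2 * (‖u - x‖ ^ 2 * inner ℝ (u - x) w) :=
  inner_gradient_of_line (differentiable_rho hf x M) (rho_line hf x u w M)

lemma inner_gradient_omega (hf : ContDiff ℝ 3 f) (x u w : E n) (M : ℝ) :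
    inner ℝ (gradient (Omega f x M) u) w =
      fderiv ℝ f x w + D2 f x (u - x) w + 1 / 2 * D3 f x (u - x) (u - x) w
        + M / 2 * (‖u - x‖ ^ 2 * inner ℝ (u - x) w) :=
  inner_gradient_of_line (differentiable_omega hf x M) (omega_line hf x u w M)

lemma bregman_rho (hf : ContDiff ℝ 3 f) (x u v : E n) (M : ℝ) :
    bregman (rho f x M) u v = 1 / 2 * D2 f x (v - u) (v - u)
      + M / 2 * (inner ℝ (u - x) (v - u) ^ 2 + ‖u - x‖ ^ 2 * ‖v - u‖ ^ 2 / 2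
        + inner ℝ (u - x) (v - u) * ‖v - u‖ ^ 2 + (‖v - u‖ ^ 2) ^ 2 / 4) := by
  have h := rho_line hf x u (v - u) M 1
  rw [one_smul, add_sub_cancel] at h
  rw [bregman, inner_gradient_rho hf, h]
  ring

/-- Ω - ρ is affine plus the cubic D³f(x)[y-x]³/6, and only the cubic contributes to the Bregman
distance. Its quadratic and cubic terms in v-u merge into one trilinear term, to which `third_le`
applies. -/
lemma bregman_omega (hf : ContDiff ℝ 3 f) (x u v : E n) (M : ℝ) :
    bregman (Omega f x M) u v = bregman (rho f x M) u v
      + 1 / 2 * D3 f x ((u - x) + (1 / 3 : ℝ) • (v - u)) (v - u) (v - u) := by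
  have h := omega_line hf x u (v - u) M 1
  rw [one_smul, add_sub_cancel] at h
  rw [bregman_rho hf, bregman, inner_gradient_omega hf, h]
  simp only [map_add, map_smul, _root_.add_apply, _root_.smul_apply,
    smul_eq_mul]
  ring

/-! ### Relative smoothness and uniform convexity of the scaling function -/

section Convex

variable (hc : ConvexOn ℝ Set.univ f) (hf : ContDiff ℝ 3 f) {L M : ℝ}
    (hL : ∀ x y, ‖iteratedFDeriv ℝ 3 f x - iteratedFDeriv ℝ 3 f y‖ ≤ L * ‖x - y‖)
    (hM : 4 * L ≤ M) (hM0 : 0 < M)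

include hc hf hM0 in
-- Drop the Hessian term. With d = ‖v-u‖² and b = ⟨u-x, v-u⟩, Cauchy–Schwarz replaces ‖u-x‖²d by b²,
-- and completing the square (3b+d)² leaves a positive multiple of d².
lemma bregman_rho_ge (x u v : E n) :
    M / 32 * ‖v - u‖ ^ 4 ≤ bregman (rho f x M) u v := by
  rw [bregman_rho hf]
  have h1 := snd_nonneg hc hf x (v - u)
  have h2 := real_inner_mul_inner_self_le (u - x) (v - u)
  rw [real_inner_self_eq_norm_sq, real_inner_self_eq_norm_sq] at h2
  set b := inner ℝ (u - x) (v - u)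
  set a := ‖u - x‖ ^ 2
  have e : ‖v - u‖ ^ 4 = (‖v - u‖ ^ 2) ^ 2 := by ring
  rw [e]
  set d := ‖v - u‖ ^ 2
  have : d ^ 2 / 16 ≤ b ^ 2 + a * d / 2 + b * d + d ^ 2 / 4 := by
    nlinarith [sq_nonneg (3 * b + d)]
  have := mul_le_mul_of_nonneg_left this (by positivity : 0 ≤ M / 2)
  linarith

include hc hf hM0 in
lemma bregman_rho_nonneg (x u v : E n) : 0 ≤ bregman (rho f x M) u v :=
  (by positivity : 0 ≤ M / 32 * ‖v - u‖ ^ 4).trans (bregman_rho_ge hc hf hM0 x u v)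

include hc hf hL hM hM0 in
/-- Relative smoothness and relative strong convexity of the model. -/
lemma abs_bregman_omega_sub_le (x u v : E n) :
    |bregman (Omega f x M) u v - bregman (rho f x M) u v| ≤
      1 / 2 * bregman (rho f x M) u v := by
  rw [bregman_omega hf, add_sub_cancel_left, abs_mul, abs_of_pos (by norm_num)]
  refine mul_le_mul_of_nonneg_left ?_ (by norm_num)
  refine (third_le hc hf hL hM x _ _).trans ?_
  rw [bregman_rho hf, norm_add_smul_sq]
  set b := inner ℝ (u - x) (v - u)
  set a := ‖u - x‖ ^ 2
  set d := ‖v - u‖ ^ 2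
  -- The terms a·d cancel, and the difference of the sides is (2/9)(3b+d)² + d²/6.
  have : (a + 2 * (1 / 3) * b + (1 / 3) ^ 2 * d) * d ≤
      2 * (b ^ 2 + a * d / 2 + b * d + d ^ 2 / 4) := by
    nlinarith [sq_nonneg (3 * b + d), sq_nonneg d]
  have := mul_le_mul_of_nonneg_left this (by positivity : 0 ≤ M / 4)
  linarith

end Convex

/-! ### Bounds through the trace of the Hessian -/

/-- Polarization with ‖b‖a ± ‖a‖b: scaling both vectors to equal norm makes the parallelogram law
give the sharp product ‖a‖‖b‖. -/
lemma abs_bilin_le {B : E n →L[ℝ] E n →L[ℝ] ℝ} {K : ℝ} (hs : ∀ a b, B a b = B b a)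
    (hK : ∀ w, |B w w| ≤ K * ‖w‖ ^ 2) (a b : E n) : |B a b| ≤ K * (‖a‖ * ‖b‖) := by
  rcases eq_or_ne a 0 with rfl | ha
  · simp
  rcases eq_or_ne b 0 with rfl | hb
  · simp
  have ha' : 0 < ‖a‖ := norm_pos_iff.2 ha
  have hb' : 0 < ‖b‖ := norm_pos_iff.2 hb
  have h1 := hK (‖b‖ • a + ‖a‖ • b)
  have h2 := hK (‖b‖ • a - ‖a‖ • b)
  have hp := parallelogram_law_with_norm ℝ (‖b‖ • a) (‖a‖ • b)
  have n1 : ‖‖b‖ • a‖ = ‖a‖ * ‖b‖ := by rw [norm_smul, norm_norm, mul_comm]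
  have n2 : ‖‖a‖ • b‖ = ‖a‖ * ‖b‖ := by rw [norm_smul, norm_norm]
  rw [n1, n2] at hp
  have e1 : B (‖b‖ • a + ‖a‖ • b) (‖b‖ • a + ‖a‖ • b) - B (‖b‖ • a - ‖a‖ • b) (‖b‖ • a - ‖a‖ • b)
      = 4 * (‖a‖ * ‖b‖) * B a b := by
    simp only [map_add, map_sub, map_smul, _root_.add_apply,
      _root_.sub_apply, _root_.smul_apply, smul_eq_mul, hs b a]
    ring
  have h3 : |4 * (‖a‖ * ‖b‖) * B a b| ≤ K * (4 * (‖a‖ * ‖b‖) ^ 2) := by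
    rw [← e1]
    refine (abs_sub _ _).trans ?_
    calc _ ≤ K * ‖‖b‖ • a + ‖a‖ • b‖ ^ 2 + K * ‖‖b‖ • a - ‖a‖ • b‖ ^ 2 := add_le_add h1 h2
      _ = K * (4 * (‖a‖ * ‖b‖) ^ 2) := by linear_combination K * hp
  rw [abs_mul, abs_of_pos (by positivity)] at h3
  have hab : 0 < 4 * (‖a‖ * ‖b‖) := by positivity
  refine le_of_mul_le_mul_left ?_ hab
  linarith

lemma hess_isSymmetric (hf : ContDiff ℝ 3 f) (x : E n) :
    (hess f x : E n →ₗ[ℝ] E n).IsSymmetric := by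
  intro a b
  simp only [ContinuousLinearMap.coe_coe]
  rw [inner_hess hf, real_inner_comm, inner_hess hf, snd_symm hf]

lemma hessTrace_nonneg (hc : ConvexOn ℝ Set.univ f) (hf : ContDiff ℝ 3 f) (x : E n) :
    0 ≤ hessTrace f x := by
  refine LinearMap.IsPositive.trace_nonneg ⟨hess_isSymmetric hf x, fun w => ?_⟩
  have := snd_nonneg hc hf x w
  rw [← inner_hess hf] at this
  simpa using this

/-- In an orthonormal eigenbasis the form is Σ λᵢ⟨bᵢ,w⟩² with λᵢ ≥ 0, and each ⟨bᵢ,w⟩² is at most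
‖w‖². -/
lemma snd_le_trace (hc : ConvexOn ℝ Set.univ f) (hf : ContDiff ℝ 3 f) (x w : E n) :
    D2 f x w w ≤ hessTrace f x * ‖w‖ ^ 2 := by
  have hT := hess_isSymmetric hf x
  have hn : Module.finrank ℝ (E n) = n := finrank_euclideanSpace_fin
  set b := hT.eigenvectorBasis hn
  have hb : ∀ i, hess f x (b i) = hT.eigenvalues hn i • b i := fun i =>
    hT.apply_eigenvectorBasis hn i
  have hev : ∀ i, 0 ≤ hT.eigenvalues hn i := by
    intro i
    have h := snd_nonneg hc hf x (b i)
    rw [← inner_hess hf, hb i, real_inner_smul_left, real_inner_self_eq_norm_sq,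
      b.orthonormal.1 i] at h
    simpa using h
  have htr : hessTrace f x = ∑ i, hT.eigenvalues hn i := by
    rw [hessTrace, hT.trace_eq_sum_eigenvalues hn]; simp
  have hw : D2 f x w w = ∑ i, hT.eigenvalues hn i * inner ℝ (b i) w ^ 2 := by
    rw [← inner_hess hf, ← b.sum_inner_mul_inner]
    refine Finset.sum_congr rfl fun i _ => ?_
    rw [inner_hess hf, snd_symm hf, ← inner_hess hf, hb i, real_inner_smul_left]
    ring
  have hle : ∀ i, inner ℝ (b i) w ^ 2 ≤ ‖w‖ ^ 2 := by
    intro i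
    have := abs_real_inner_le_norm (b i) w
    rw [b.orthonormal.1 i, one_mul] at this
    exact sq_le_sq' (by linarith [neg_le_of_abs_le this]) (le_of_abs_le this)
  rw [hw, htr, Finset.sum_mul]
  exact Finset.sum_le_sum fun i _ => mul_le_mul_of_nonneg_left (hle i) (hev i)

lemma norm_cubic_sub_le {a b : E n} {R : ℝ} (ha : ‖a‖ ≤ R) (hb : ‖b‖ ≤ R) (w : E n) :
    |‖a‖ ^ 2 * inner ℝ a w - ‖b‖ ^ 2 * inner ℝ b w| ≤ 3 * R ^ 2 * (‖a - b‖ * ‖w‖) := by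
  have e : ‖a‖ ^ 2 * inner ℝ a w - ‖b‖ ^ 2 * inner ℝ b w =
      ‖a‖ ^ 2 * inner ℝ (a - b) w + (‖a‖ + ‖b‖) * (‖a‖ - ‖b‖) * inner ℝ b w := by
    rw [inner_sub_left]; ring
  rw [e]
  have h1 := abs_real_inner_le_norm (a - b) w
  have h2 := abs_real_inner_le_norm b w
  have h3 := abs_norm_sub_norm_le a b
  have hR : 0 ≤ R := (norm_nonneg a).trans ha
  refine (abs_add_le _ _).trans ?_
  rw [abs_mul, abs_mul, abs_mul, abs_of_nonneg (by positivity : 0 ≤ ‖a‖ ^ 2),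
    abs_of_nonneg (by positivity : 0 ≤ ‖a‖ + ‖b‖)]
  calc _ ≤ R ^ 2 * (‖a - b‖ * ‖w‖) + (R + R) * ‖a - b‖ * (R * ‖w‖) := by
        gcongr
        exact h2.trans (by gcongr)
    _ = _ := by ring

section Convex

variable (hc : ConvexOn ℝ Set.univ f) (hf : ContDiff ℝ 3 f) {L M : ℝ}
    (hL : ∀ x y, ‖iteratedFDeriv ℝ 3 f x - iteratedFDeriv ℝ 3 f y‖ ≤ L * ‖x - y‖)
    (hM : 4 * L ≤ M) (hM0 : 0 < M)

include hc hf hL hM hM0 in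
-- The residual vector is -2(∇ρ(v) - ∇ρ(u)) plus the increment of the quadratic ½D³f(x)[y-x]²
-- between u and v. That increment is exactly D³f(x)[·, v-u] at the midpoint, which stays in the
-- ball of radius R. Each piece is Lipschitz there, and testing against the residual itself gives
-- its norm.
lemma residual_le {x u v : E n} {R : ℝ} (hu : ‖u - x‖ ≤ R) (hv : ‖v - x‖ ≤ R) :
    residual f x M u v ≤ 3 * (hessTrace f x + 3 * M / 2 * R ^ 2) * ‖v - u‖ := by
  have hR : 0 ≤ R := (norm_nonneg _).trans hu
  have hA : ∀ a b, |D2 f x a b| ≤ hessTrace f x * (‖a‖ * ‖b‖) :=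
    abs_bilin_le (snd_symm hf x) fun w => by
      rw [abs_of_nonneg (snd_nonneg hc hf x w)]
      exact snd_le_trace hc hf x w
  have htr := hessTrace_nonneg hc hf x
  have hmid : ‖(u - x) + (1 / 2 : ℝ) • (v - u)‖ ≤ R := by
    have e : (u - x) + (1 / 2 : ℝ) • (v - u) = (1 / 2 : ℝ) • (u - x) + (1 / 2 : ℝ) • (v - x) := by
      module
    rw [e]
    refine (norm_add_le _ _).trans ?_
    rw [norm_smul, norm_smul]
    norm_num
    linarith
  have hC : ∀ a b, |D3 f x ((u - x) + (1 / 2 : ℝ) • (v - u)) a b| ≤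
      (1 / 2 * hessTrace f x + M / 4 * R ^ 2) * (‖a‖ * ‖b‖) :=
    abs_bilin_le (third_symm_right hf x _) fun w => by
      refine (third_le hc hf hL hM x _ w).trans ?_
      have h1 := snd_le_trace hc hf x w
      have h2 : M / 4 * (‖(u - x) + (1 / 2 : ℝ) • (v - u)‖ ^ 2 * ‖w‖ ^ 2) ≤
          M / 4 * (R ^ 2 * ‖w‖ ^ 2) := by gcongr
      linarith
  set q := gradient (Omega f x M) v + gPsi f x M u v with hq
  have hqw : ∀ w, inner ℝ q w = -(2 * D2 f x (v - u) w)
      + D3 f x ((u - x) + (1 / 2 : ℝ) • (v - u)) (v - u) w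
      - M * (‖v - x‖ ^ 2 * inner ℝ (v - x) w - ‖u - x‖ ^ 2 * inner ℝ (u - x) w) := by
    intro w
    have e : v - x = (u - x) + (v - u) := by abel
    rw [hq, gPsi, inner_add_left, inner_add_left, inner_neg_left, real_inner_smul_left,
      inner_sub_left, inner_gradient_omega hf, inner_gradient_omega hf, inner_gradient_rho hf,
      inner_gradient_rho hf]
    have e2 : D2 f x (v - x) w = D2 f x (u - x) w + D2 f x (v - u) w := by
      rw [e, map_add, _root_.add_apply]
    have e3 : D3 f x (v - x) (v - x) w = D3 f x (u - x) (u - x) w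
        + 2 * D3 f x ((u - x) + (1 / 2 : ℝ) • (v - u)) (v - u) w := by
      rw [e]
      simp only [map_add, map_smul, _root_.add_apply,
        _root_.smul_apply, smul_eq_mul]
      rw [third_symm_left hf x (v - u) (u - x) w]
      ring
    rw [e2, e3]
    ring
  have key : ‖q‖ ^ 2 ≤ 3 * (hessTrace f x + 3 * M / 2 * R ^ 2) * ‖v - u‖ * ‖q‖ := by
    rw [← real_inner_self_eq_norm_sq, hqw q]
    have h1 := neg_le_of_abs_le (hA (v - u) q)
    have h2 := le_of_abs_le (hC (v - u) q)
    have h3 := neg_le_of_abs_le (norm_cubic_sub_le hv hu q)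
    rw [sub_sub_sub_cancel_right] at h3
    have h4 := mul_le_mul_of_nonneg_left h3 hM0.le
    have h5 : 0 ≤ hessTrace f x * (‖v - u‖ * ‖q‖) := (abs_nonneg _).trans (hA _ _)
    have h6 : 0 ≤ M * R ^ 2 * (‖v - u‖ * ‖q‖) := by positivity
    nlinarith
  show ‖q‖ ≤ _
  rcases (norm_nonneg q).eq_or_lt with h0 | h0
  · rw [← h0]
    positivity
  · exact le_of_mul_le_mul_right (by linarith [sq ‖q‖]) h0

end Convex

/-! ### Subgradients and Bregman gradient steps -/

variable {ψ : E n → EReal}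

lemma ConvexExt.coe_toReal (hψ : ConvexExt ψ) {x : E n} (hx : x ∈ effDom ψ) :
    (((ψ x).toReal : ℝ) : EReal) = ψ x :=
  EReal.coe_toReal (ne_of_lt hx) (hψ.1 x)

lemma ConvexExt.toReal_le (hψ : ConvexExt ψ) {x y : E n} (hx : x ∈ effDom ψ)
    (hy : y ∈ effDom ψ) {t : ℝ} (ht0 : 0 ≤ t) (ht1 : t ≤ 1) :
    x + t • (y - x) ∈ effDom ψ ∧
      (ψ (x + t • (y - x))).toReal ≤ (ψ x).toReal + t * ((ψ y).toReal - (ψ x).toReal) := by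
  have h := hψ.2 x y (1 - t) t (by linarith) ht0 (by ring)
  rw [show (1 - t) • x + t • y = x + t • (y - x) by module, ← hψ.coe_toReal hx,
    ← hψ.coe_toReal hy, ← EReal.coe_mul, ← EReal.coe_mul, ← EReal.coe_add] at h
  have hd : x + t • (y - x) ∈ effDom ψ := h.trans_lt (EReal.coe_lt_top _)
  refine ⟨hd, ?_⟩
  rw [← hψ.coe_toReal hd, EReal.coe_le_coe_iff] at h
  linarith

/-- First-order optimality condition for the sum of a differentiable and a convex function. -/
lemma ConvexExt.optimality (hψ : ConvexExt ψ) {s : E n → ℝ} {v y : E n} (hv : v ∈ effDom ψ)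
    (hy : y ∈ effDom ψ) (hmin : ∀ z ∈ effDom ψ, s v + (ψ v).toReal ≤ s z + (ψ z).toReal)
    {c : ℝ} (hc : HasDerivAt (fun t : ℝ => s (v + t • (y - v))) c 0) :
    (ψ v).toReal - c ≤ (ψ y).toReal := by
  have h1 : Filter.Tendsto (slope (fun t : ℝ => s (v + t • (y - v))) 0)
      (nhdsWithin 0 (Set.Ioi 0)) (nhds c) :=
    (hasDerivAt_iff_tendsto_slope.1 hc).mono_left
      (nhdsWithin_mono _ fun t (ht : 0 < t) => ne_of_gt ht)
  have h2 : (ψ v).toReal - (ψ y).toReal ≤ c := by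
    refine ge_of_tendsto h1 ?_
    filter_upwards [Ioc_mem_nhdsGT (zero_lt_one (α := ℝ))] with t ht
    obtain ⟨hd, hle⟩ := hψ.toReal_le hv hy ht.1.le ht.2
    have := hmin _ hd
    rw [slope_def_field, zero_smul, add_zero, sub_zero, le_div_iff₀ ht.1]
    linarith
  linarith

lemma composite_toReal (hψ : ConvexExt ψ) {x : E n} (hx : x ∈ effDom ψ) :
    composite f ψ x = ((f x + (ψ x).toReal : ℝ) : EReal) := by
  rw [composite, EReal.coe_add, hψ.coe_toReal hx]

lemma gap_eq (hψ : ConvexExt ψ) {x y : E n} (hx : x ∈ effDom ψ) (hy : y ∈ effDom ψ) :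
    gap f ψ x y = (f x + (ψ x).toReal) - (f y + (ψ y).toReal) := by
  rw [gap, composite_toReal hψ hx, composite_toReal hψ hy, EReal.toReal_coe, EReal.toReal_coe]

/-- By definition of G, x minimizes f - ⟨G, · - x⟩ + ψ; the optimality condition then says that G -
∇f(x) is a subgradient of ψ. -/
lemma subgradient_nonsmooth (hf : ContDiff ℝ 3 f) (hψ : ConvexExt ψ) {x G y : E n}
    (hx : x ∈ effDom ψ) (hy : y ∈ effDom ψ) (hG : G ∈ subdiff (composite f ψ) x) :
    (ψ x).toReal + (inner ℝ G (y - x) - fderiv ℝ f x (y - x)) ≤ (ψ y).toReal := by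
  have hd : Differentiable ℝ f := hf.differentiable (by norm_num)
  have hc : HasDerivAt (fun t : ℝ => f (x + t • (y - x)) - inner ℝ G (x + t • (y - x) - x))
      (fderiv ℝ f x (y - x) - inner ℝ G (y - x)) 0 := by
    have h1 := hasDerivAt_comp_line hd x (y - x) 0
    rw [zero_smul, add_zero] at h1
    refine h1.fun_sub ?_
    simp only [add_sub_cancel_left, real_inner_smul_right]
    simpa using (hasDerivAt_id (0 : ℝ)).mul_const (inner ℝ G (y - x))
  have := hψ.optimality (s := fun z => f z - inner ℝ G (z - x)) hx hy (fun z hz => by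
    have h := hG z
    rw [composite_toReal hψ hx, composite_toReal hψ hz, ← EReal.coe_add,
      EReal.coe_le_coe_iff] at h
    simp only [sub_self, inner_zero_right]
    linarith) hc
  linarith

lemma IsStep.mem_effDom (hψ : ConvexExt ψ) {x u v : E n} {M : ℝ} (h : IsStep f ψ x M u v)
    (hu : u ∈ effDom ψ) : v ∈ effDom ψ := by
  have h1 := h u
  rw [stepObj, stepObj, ← hψ.coe_toReal hu, ← EReal.coe_add] at h1
  by_contra hv
  have ht : ψ v = ⊤ := not_lt_top_iff.1 hv
  rw [ht, EReal.coe_add_top] at h1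
  exact absurd h1 (not_le.2 (EReal.coe_lt_top _))

/-- The vector g_ψ(v) is minus the gradient at v of the smooth part of the step objective, so
optimality of v makes it a subgradient of ψ. -/
lemma IsStep.subgradient (hf : ContDiff ℝ 3 f) (hψ : ConvexExt ψ) {x u v y : E n} {M : ℝ}
    (h : IsStep f ψ x M u v) (hv : v ∈ effDom ψ) (hy : y ∈ effDom ψ) :
    (ψ v).toReal + inner ℝ (gPsi f x M u v) (y - v) ≤ (ψ y).toReal := by
  have hρ := hasDerivAt_comp_line (differentiable_rho hf x M) v (y - v) 0
  rw [zero_smul, add_zero, ← inner_gradient_left] at hρ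
  have hlin : ∀ g : E n, HasDerivAt (fun t : ℝ => inner ℝ g (v + t • (y - v) - u))
      (inner ℝ g (y - v)) 0 := by
    intro g
    have e : (fun t : ℝ => inner ℝ g (v + t • (y - v) - u)) =
        fun t : ℝ => inner ℝ g (v - u) + t * inner ℝ g (y - v) := by
      funext t
      rw [show v + t • (y - v) - u = (v - u) + t • (y - v) by abel, inner_add_right,
        real_inner_smul_right]
    rw [e]
    simpa using ((hasDerivAt_id (0 : ℝ)).mul_const (inner ℝ g (y - v))).const_add
      (inner ℝ g (v - u))
  have hc := (hlin (gradient (Omega f x M) u)).fun_add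
    (((hρ.sub_const (rho f x M u)).fun_sub (hlin (gradient (rho f x M) u))).const_mul 3)
  have := hψ.optimality (s := fun z => inner ℝ (gradient (Omega f x M) u) (z - u)
    + 3 * bregman (rho f x M) u z) hv hy (fun z hz => by
      have h1 := h z
      rw [stepObj, stepObj, ← hψ.coe_toReal hv, ← hψ.coe_toReal hz, ← EReal.coe_add,
        ← EReal.coe_add, EReal.coe_le_coe_iff] at h1
      exact h1) hc
  rw [gPsi, inner_add_left, inner_neg_left, real_inner_smul_left, inner_sub_left]
  linarith

lemma subgradient_composite (hc : ConvexOn ℝ Set.univ f) (hf : ContDiff ℝ 3 f)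
    (hψ : ConvexExt ψ) {x u v y : E n} {M : ℝ}
    (h : IsStep f ψ x M u v) (hv : v ∈ effDom ψ) (hy : y ∈ effDom ψ) :
    inner ℝ (gradient f v + gPsi f x M u v) (v - y) ≥ gap f ψ v y := by
  have h1 := h.subgradient hf hψ hv hy
  have h2 := fderiv_line_le hc hf v y
  rw [← inner_gradient_left] at h2
  rw [gap_eq hψ hv hy, inner_add_left, ← neg_sub y v, inner_neg_right, inner_neg_right]
  linarith

/-- The smooth-plus-convex model `Ω + ψ` as a real number. -/
noncomputable def modelVal (f : E n → ℝ) (ψ : E n → EReal) (x : E n) (M : ℝ) (y : E n) : ℝ :=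
  Omega f x M y + (ψ y).toReal

/-! ### Linear convergence of the inner Bregman gradient method -/

section Step

variable (hc : ConvexOn ℝ Set.univ f) (hf : ContDiff ℝ 3 f) {L M : ℝ}
    (hL : ∀ x y, ‖iteratedFDeriv ℝ 3 f x - iteratedFDeriv ℝ 3 f y‖ ≤ L * ‖x - y‖)
    (hM : 4 * L ≤ M) (hM0 : 0 < M) (hψ : ConvexExt ψ)

include hc hf hL hM hM0 hψ

/-- The three-point identity for 3β_ρ, with relative strong convexity at y (3 - 1/2 = 5/2) and
relative smoothness at v (3 - 3/2 = 3/2). If the left side is nonnegative, β_ρ(v,y) ≤ (5/6)β_ρ(u,y).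
-/
lemma IsStep.model_sub_le {x u v y : E n} (h : IsStep f ψ x M u v) (hv : v ∈ effDom ψ)
    (hy : y ∈ effDom ψ) :
    modelVal f ψ x M v - modelVal f ψ x M y ≤ 5 / 2 * bregman (rho f x M) u y
      - 3 * bregman (rho f x M) v y - 3 / 2 * bregman (rho f x M) u v := by
  have h1 := h.subgradient hf hψ hv hy
  have h2 := (abs_le.1 (abs_bregman_omega_sub_le hc hf hL hM hM0 x u y)).1
  have h3 := (abs_le.1 (abs_bregman_omega_sub_le hc hf hL hM hM0 x u v)).2
  rw [gPsi, inner_add_left, inner_neg_left, real_inner_smul_left, inner_sub_left] at h1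
  have e1 : ∀ g : E n, inner ℝ g (y - v) = inner ℝ g (y - u) - inner ℝ g (v - u) := by
    intro g
    rw [← inner_sub_right, sub_sub_sub_cancel_right]
  rw [e1 (gradient (Omega f x M) u), e1 (gradient (rho f x M) u)] at h1
  rw [modelVal, modelVal]
  simp only [bregman] at h2 h3 ⊢
  linarith

lemma IsStep.model_le {x u v : E n} (h : IsStep f ψ x M u v) (hv : v ∈ effDom ψ)
    (hu : u ∈ effDom ψ) : modelVal f ψ x M v ≤ modelVal f ψ x M u := by
  have h1 := h.model_sub_le hc hf hL hM hM0 hψ hv hu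
  have h2 : bregman (rho f x M) u u = 0 := by simp [bregman]
  have h3 := bregman_rho_nonneg hc hf hM0 x v u
  have h4 := bregman_rho_nonneg hc hf hM0 x u v
  linarith

/-- As G - ∇f(x) ∈ ∂ψ(x), model descent gives ½β_ρ(x,y) ≤ ‖G‖‖y-x‖; the quartic lower bound then
yields ‖y-x‖³ ≤ 64‖G‖/M, within the stated radius. -/
lemma norm_sub_le_of_model_le {x G y : E n} (hx : x ∈ effDom ψ)
    (hG : G ∈ subdiff (composite f ψ) x) (hy : y ∈ effDom ψ)
    (hle : modelVal f ψ x M y ≤ modelVal f ψ x M x) :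
    ‖y - x‖ ≤ (96 * ‖G‖ / M) ^ (1 / 3 : ℝ) := by
  have h1 := subgradient_nonsmooth hf hψ hx hy hG
  have h2 := (abs_le.1 (abs_bregman_omega_sub_le hc hf hL hM hM0 x x y)).1
  have h3 := bregman_rho_ge hc hf hM0 x x y
  have h4 : inner ℝ (gradient (Omega f x M) x) (y - x) = fderiv ℝ f x (y - x) := by
    rw [inner_gradient_omega hf]; simp
  have h5 := (abs_le.1 (abs_real_inner_le_norm G (y - x))).1
  rw [modelVal, modelVal] at hle
  have h7 : bregman (Omega f x M) x y = Omega f x M y - Omega f x M x - fderiv ℝ f x (y - x) := by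
    rw [bregman, h4]
  have h6 : M / 64 * ‖y - x‖ ^ 4 ≤ ‖G‖ * ‖y - x‖ := by linarith
  have hq : 0 ≤ 96 * ‖G‖ / M := by positivity
  apply le_of_pow_three_le (by positivity)
  rw [rpow_third_pow_three hq, le_div_iff₀ hM0]
  rcases (norm_nonneg (y - x)).eq_or_lt with h0 | h0
  · rw [← h0]; simp
  · have : M / 64 * ‖y - x‖ ^ 3 ≤ ‖G‖ := by
      refine le_of_mul_le_mul_right ?_ h0
      linarith [h6]
    linarith [norm_nonneg G]

/-- If the regularization parameter dominates `4 L`, the inner method never reports slow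
convergence. -/
lemma not_stopSlow {x G : E n} (hx : x ∈ effDom ψ) (hG : G ∈ subdiff (composite f ψ) x)
    {y : ℕ → E n} {K : ℕ} (hy0 : y 0 = x) (hstep : ∀ k ≤ K, IsStep f ψ x M (y k) (y (k + 1))) :
    ¬ StopSlow f x G M K (y K) (y (K + 1)) := by
  have hdom : ∀ k ≤ K + 1, y k ∈ effDom ψ := by
    intro k
    induction k with
    | zero => intro _; rwa [hy0]
    | succ k ih => intro hk; exact (hstep k (by omega)).mem_effDom hψ (ih (by omega))
  have hdec : ∀ k ≤ K, modelVal f ψ x M (y (k + 1)) ≤ modelVal f ψ x M (y k) := fun k hk =>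
    (hstep k hk).model_le hc hf hL hM hM0 hψ (hdom _ (by omega)) (hdom _ (by omega))
  have hle0 : ∀ k ≤ K + 1, modelVal f ψ x M (y k) ≤ modelVal f ψ x M x := by
    intro k
    induction k with
    | zero => intro _; rw [hy0]
    | succ k ih => intro hk; exact (hdec k (by omega)).trans (ih (by omega))
  have hge : ∀ j ≤ K + 1, modelVal f ψ x M (y (K + 1)) ≤ modelVal f ψ x M (y (K + 1 - j)) := by
    intro j
    induction j with
    | zero => intro _; rfl
    | succ j ih =>
      intro hj
      have := hdec (K + 1 - (j + 1)) (by omega)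
      rw [show K + 1 - (j + 1) + 1 = K + 1 - j by omega] at this
      exact (ih (by omega)).trans this
  set R := (96 * ‖G‖ / M) ^ (1 / 3 : ℝ) with hR
  have hq : 0 ≤ 96 * ‖G‖ / M := by positivity
  have hR0 : 0 ≤ R := by positivity
  have hnorm : ∀ k ≤ K + 1, ‖y k - x‖ ≤ R := fun k hk =>
    norm_sub_le_of_model_le hc hf hL hM hM0 hψ hx hG (hdom k hk) (hle0 k hk)
  -- The last iterate serves as the comparison point: it has the least model value so far, so no
  -- minimizer of the model is needed.
  set z := y (K + 1) with hz
  have hcontr : ∀ k ≤ K, bregman (rho f x M) (y k) z ≤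
      (5 / 6) ^ k * bregman (rho f x M) x z := by
    intro k
    induction k with
    | zero => intro _; rw [hy0]; simp
    | succ k ih =>
      intro hk
      have h1 := (hstep k (by omega)).model_sub_le hc hf hL hM hM0 hψ (hdom (k + 1) (by omega))
        (hdom (K + 1) le_rfl)
      have h2 := hge (K - k) (by omega)
      rw [show K + 1 - (K - k) = k + 1 by omega] at h2
      have h3 := bregman_rho_nonneg hc hf hM0 x (y k) (y (k + 1))
      rw [pow_succ]
      linarith [ih (by omega)]
  have hbeta : bregman (rho f x M) x z ≤ betaConst f x G M := by
    rw [bregman_rho hf, betaConst, rpow_two_thirds hq, rpow_four_thirds hq, ← hR, sub_self]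
    simp only [inner_zero_left, norm_zero]
    have h1 := snd_le_trace hc hf x (z - x)
    have h2 := hnorm (K + 1) le_rfl
    rw [← hz] at h2
    have h3 : ‖z - x‖ ^ 2 ≤ R ^ 2 := by gcongr
    have h4 : ‖z - x‖ ^ 4 ≤ R ^ 4 := by gcongr
    have h5 : hessTrace f x * ‖z - x‖ ^ 2 ≤ hessTrace f x * R ^ 2 :=
      mul_le_mul_of_nonneg_left h3 (hessTrace_nonneg hc hf x)
    have h6 := mul_le_mul_of_nonneg_left h4 hM0.le
    linarith
  have hres := residual_le hc hf hL hM hM0 (hnorm K (by omega)) (hnorm (K + 1) le_rfl)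
  rw [← hz] at hres
  have hlow := bregman_rho_ge hc hf hM0 x (y K) z
  have hup := (hcontr K le_rfl).trans
    (mul_le_mul_of_nonneg_left hbeta (by positivity : (0 : ℝ) ≤ (5 / 6) ^ K))
  have hL' : Lconst f x G M = hessTrace f x + 3 * M / 2 * R ^ 2 := by
    rw [Lconst, rpow_two_thirds hq]
  rw [← hL'] at hres
  rw [StopSlow, not_lt]
  have h4 : residual f x M (y K) z ^ 4 ≤ (3 * Lconst f x G M * ‖z - y K‖) ^ 4 :=
    pow_le_pow_left₀ (norm_nonneg _) hres 4
  have h5 : ‖z - y K‖ ^ 4 ≤ 32 / M * ((5 / 6) ^ K * betaConst f x G M) := by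
    rw [div_mul_eq_mul_div, le_div_iff₀ hM0]
    linarith
  have h6 : 0 ≤ (5 / 6 : ℝ) ^ K * betaConst f x G M :=
    (bregman_rho_nonneg hc hf hM0 x _ _).trans hup
  calc residual f x M (y K) z ^ 4 ≤ 81 * Lconst f x G M ^ 4 * ‖z - y K‖ ^ 4 := by
        linarith [h4]
    _ ≤ 81 * Lconst f x G M ^ 4 * (32 / M * ((5 / 6) ^ K * betaConst f x G M)) := by gcongr
    -- 81·32 = 2592 is below 3⁸/2.
    _ ≤ 3 ^ 8 * Lconst f x G M ^ 4 / (2 * M) * ((5 / 6) ^ K * betaConst f x G M) := by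
        rw [← mul_assoc]
        refine mul_le_mul_of_nonneg_right ?_ h6
        rw [mul_div_assoc', div_le_div_iff₀ hM0 (by positivity)]
        have : 0 ≤ Lconst f x G M ^ 4 * M := by positivity
        nlinarith
    _ = _ := by
        have : ((5 / 6 : ℝ)) ^ K = ((6 / 5 : ℝ) ^ K)⁻¹ := by rw [← inv_pow]; norm_num
        rw [this]
        field_simp

end Step

/-! ### The outer method -/

/-- A successful inner run passes the acceptance test once the regularization parameter
dominates `4 L`. -/
lemma accept_of_stopSuccess (hc : ConvexOn ℝ Set.univ f) (hf : ContDiff ℝ 3 f) {L M ε : ℝ}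
    (hL : ∀ x y, ‖iteratedFDeriv ℝ 3 f x - iteratedFDeriv ℝ 3 f y‖ ≤ L * ‖x - y‖)
    (hM : 4 * L ≤ M) (hM0 : 0 < M) (hψ : ConvexExt ψ) {x u v : E n}
    (h : IsStep f ψ x M u v) (hx : x ∈ effDom ψ) (hv : v ∈ effDom ψ)
    (hs : StopSuccess f x M ε u v) (hε : ε ≤ ‖gradient f v + gPsi f x M u v‖) :
    Accept f ψ x M v (gradient f v + gPsi f x M u v) := by
  have hgap := subgradient_composite hc hf hψ h hv hx
  set g := gradient f v + gPsi f x M u v with hg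
  set q := gradient (Omega f x M) v + gPsi f x M u v with hq
  set r := ‖v - x‖ with hr
  have hr0 : 0 ≤ r := norm_nonneg _
  have hres : residual f x M u v = ‖q‖ := rfl
  have hw : ∀ w, |inner ℝ g w - (inner ℝ q w - M / 2 * (r ^ 2 * inner ℝ (v - x) w))| ≤
      M / 24 * r ^ 3 * ‖w‖ := by
    intro w
    have h1 := fderiv_taylor hf hL x (v - x) w
    rw [add_sub_cancel] at h1
    have e : inner ℝ g w - (inner ℝ q w - M / 2 * (r ^ 2 * inner ℝ (v - x) w)) =
        fderiv ℝ f v w - (fderiv ℝ f x w + D2 f x (v - x) w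
          + 1 / 2 * D3 f x (v - x) (v - x) w) := by
      rw [hg, hq, inner_add_left, inner_add_left, inner_gradient_omega hf, inner_gradient_left]
      ring
    rw [e]
    refine h1.trans ?_
    have : L / 6 ≤ M / 24 := by linarith
    gcongr
  -- 13/24 = 1/2 + 1/24: the quartic regularizer plus the Taylor remainder.
  have hgn : ‖g‖ ≤ ‖q‖ + 13 / 24 * (M * r ^ 3) := by
    rcases (norm_nonneg g).eq_or_lt with h0 | h0
    · rw [← h0]; positivity
    · have h1 := (abs_le.1 (hw g)).2
      rw [real_inner_self_eq_norm_sq] at h1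
      have h2 := (abs_le.1 (abs_real_inner_le_norm q g)).2
      have h3 := (abs_le.1 (abs_real_inner_le_norm (v - x) g)).1
      rw [← hr] at h3
      have h4 : M / 2 * r ^ 2 * (-(r * ‖g‖)) ≤ M / 2 * r ^ 2 * inner ℝ (v - x) g := by gcongr
      refine le_of_mul_le_mul_right ?_ h0
      linarith
  -- Under the test ‖q‖ ≤ ε/7 ≤ ‖g‖/7, the bound on ‖g‖ gives 6‖q‖ ≤ (13/24)Mr³, so both stopping
  -- tests lead to the same estimate.
  have hqr : ‖q‖ ≤ M / 6 * r ^ 3 := by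
    rcases hs with hs | hs
    · rw [hres] at hs
      have : 0 ≤ M * r ^ 3 := by positivity
      linarith
    · exact hs
  have hdec : 7 / 24 * (M * r ^ 4) ≤ inner ℝ g (x - v) := by
    have h1 := (abs_le.1 (hw (x - v))).1
    have h2 := (abs_le.1 (abs_real_inner_le_norm q (x - v))).1
    rw [← neg_sub v x, norm_neg, inner_neg_right, inner_neg_right, inner_neg_right,
      real_inner_self_eq_norm_sq, ← hr] at h1
    rw [← neg_sub v x, norm_neg, inner_neg_right, ← hr] at h2
    rw [← neg_sub v x, inner_neg_right]
    have h3 : ‖q‖ * r ≤ M / 6 * r ^ 3 * r := by gcongr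
    linarith
  have hgap' : inner ℝ g (x - v) ≤ gap f ψ x v := by
    have e1 : gap f ψ v x = -gap f ψ x v := by rw [gap, gap]; ring
    rw [e1, ← neg_sub x v, inner_neg_right] at hgap
    linarith
  refine le_trans ?_ (hdec.trans hgap')
  have hM3 : 0 < M ^ (1 / 3 : ℝ) := Real.rpow_pos_of_pos hM0 _
  have hMc := rpow_third_pow_three hM0.le
  have hgr : ‖g‖ ^ (1 / 3 : ℝ) ≤ M ^ (1 / 3 : ℝ) * r := by
    apply le_of_pow_three_le (by positivity)
    rw [rpow_third_pow_three (norm_nonneg _), mul_pow, hMc]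
    have : 0 ≤ M * r ^ 3 := by positivity
    linarith
  rw [rpow_four_thirds (norm_nonneg _), div_mul_eq_mul_div, one_mul, div_le_iff₀ (by positivity)]
  calc (‖g‖ ^ (1 / 3 : ℝ)) ^ 4 ≤ (M ^ (1 / 3 : ℝ) * r) ^ 4 := by gcongr
    _ = (M ^ (1 / 3 : ℝ)) ^ 3 * r ^ 4 * M ^ (1 / 3 : ℝ) := by ring
    _ = M * r ^ 4 * M ^ (1 / 3 : ℝ) := by rw [hMc]
    _ ≤ 7 / 24 * (M * r ^ 4) * (6 * M ^ (1 / 3 : ℝ)) := by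
      have : 0 ≤ M * r ^ 4 * M ^ (1 / 3 : ℝ) := by positivity
      linarith

lemma Alg1Output.exists_step (hψ : ConvexExt ψ) {ε M : ℝ} {x G xp gp : E n} {α : Bool}
    (h : Alg1Output f ψ ε x G M xp gp α) :
    xp ∈ effDom ψ ∧ ∃ u, IsStep f ψ x M u xp ∧ gp = gPsi f x M u xp ∧
      (α = false → StopSuccess f x M ε u xp) := by
  obtain ⟨hx, -, y, K, hy0, hstep, -, rfl, rfl, hα⟩ := h
  have hdom : ∀ k ≤ K + 1, y k ∈ effDom ψ := by
    intro k
    induction k with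
    | zero => intro _; rwa [hy0]
    | succ k ih => intro hk; exact (hstep k (by omega)).mem_effDom hψ (ih (by omega))
  refine ⟨hdom _ le_rfl, y K, hstep K le_rfl, rfl, fun h => ?_⟩
  rcases hα with ⟨hs, -⟩ | ⟨-, -, hα⟩
  · exact hs
  · simp [h] at hα

/-! ### Accepted parameters and the recursion for the gap -/

section Run

variable {L M₀ ε : ℝ} {T : ℕ}

lemma Alg2Run.mem_effDom (hψ : ConvexExt ψ) (run : Alg2Run f ψ M₀ ε T) :
    ∀ t ≤ T, run.x t ∈ effDom ψ := by
  intro t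
  cases t with
  | zero => intro _; exact run.x_zero_mem
  | succ t =>
    intro ht
    obtain ⟨G, hG⟩ := run.inner t (by omega) _ ⟨run.istart_le t (by omega), le_rfl⟩
    rw [run.x_succ t (by omega)]
    exact (hG.exists_step hψ).1

lemma Alg2Run.M_pos (hM₀ : 0 < M₀) (run : Alg2Run f ψ M₀ ε T) : ∀ t ≤ T, 0 < run.M t := by
  intro t
  induction t with
  | zero => intro _; rwa [run.M_zero]
  | succ t ih =>
    intro ht
    rw [run.M_succ t (by omega)]
    have := ih (by omega)
    positivity

/-- If the first trial is accepted, minimality of its index (or, for index 0, the bound on M_t)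
suffices. Otherwise the preceding trial was rejected, which is impossible at parameter at least 4L,
so one doubling stays below 8L. -/
lemma Alg2Run.trial_le (hc : ConvexOn ℝ Set.univ f) (hf : ContDiff ℝ 3 f)
    (hL : ∀ x y, ‖iteratedFDeriv ℝ 3 f x - iteratedFDeriv ℝ 3 f y‖ ≤ L * ‖x - y‖)
    (hψ : ConvexExt ψ) (hM₀ : 0 < M₀) (run : Alg2Run f ψ M₀ ε T)
    {t : ℕ} (ht : t < T) (hMt : run.M t ≤ max (4 * M₀) (8 * L) / 2) :
    2 ^ run.iacc t * run.M t ≤ max (4 * M₀) (8 * L) := by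
  have hMpos := run.M_pos hM₀ t ht.le
  rcases (run.istart_le t ht).eq_or_lt with heq | hlt
  · rw [← heq]
    rcases Nat.eq_zero_or_pos (run.istart t) with h0 | h0
    · rw [h0]; linarith
    · obtain ⟨s, hs⟩ := Nat.exists_eq_add_of_le' h0
      have h1 : ¬ 2 * M₀ ≤ 2 ^ s * run.M t := fun h => by
        have := (run.istart_least t ht).2 h
        omega
      refine le_max_of_le_left ?_
      rw [hs, pow_succ]
      linarith
  · obtain ⟨j, hj⟩ : ∃ j, run.iacc t = j + 1 := ⟨run.iacc t - 1, by omega⟩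
    have hj1 : run.istart t ≤ j := by omega
    obtain ⟨G, hG⟩ := run.inner t ht j ⟨hj1, by omega⟩
    by_cases hbig : 4 * L ≤ 2 ^ j * run.M t
    · exfalso
      have hpos : 0 < 2 ^ j * run.M t := by positivity
      rcases run.rejected t ht j hj1 (by omega) with hα | ⟨hα, hε, hacc⟩
      · rw [hα] at hG
        obtain ⟨hx, hGs, y, K, hy0, hstep, -, -, -, ⟨-, h⟩ | ⟨-, h, -⟩⟩ := hG
        · cases h
        · exact not_stopSlow hc hf hL hbig hpos hψ hx hGs hy0 hstep h
      · obtain ⟨hd, u, hstep, hgp, hs⟩ := hG.exists_step hψ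
        rw [hgp] at hacc hε
        exact hacc (accept_of_stopSuccess hc hf hL hbig hpos hψ hstep
          (run.mem_effDom hψ t ht.le) hd (hs hα) hε.le)
    · refine le_max_of_le_right ?_
      rw [hj, pow_succ]
      linarith

/-- Halving the accepted parameter restores the bound on M_{t+1} that the next iteration requires.
-/
lemma Alg2Run.accepted_le (hc : ConvexOn ℝ Set.univ f) (hf : ContDiff ℝ 3 f)
    (hL : ∀ x y, ‖iteratedFDeriv ℝ 3 f x - iteratedFDeriv ℝ 3 f y‖ ≤ L * ‖x - y‖)
    (hψ : ConvexExt ψ) (hM₀ : 0 < M₀) (run : Alg2Run f ψ M₀ ε T) {t : ℕ} (ht : t < T) :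
    2 ^ run.iacc t * run.M t ≤ max (4 * M₀) (8 * L) := by
  have hM : ∀ t < T, run.M t ≤ max (4 * M₀) (8 * L) / 2 := by
    intro t
    induction t with
    | zero =>
      intro _
      rw [run.M_zero]
      have := le_max_left (4 * M₀) (8 * L)
      linarith
    | succ t ih =>
      intro ht
      rw [run.M_succ t (by omega)]
      have := run.trial_le hc hf hL hψ hM₀ (by omega) (ih (by omega))
      linarith
  exact run.trial_le hc hf hL hψ hM₀ ht (hM t ht)

lemma Alg2Run.gap_succ_le (hM₀ : 0 < M₀) (run : Alg2Run f ψ M₀ ε T) (xs : E n) {t : ℕ}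
    (ht : t < T) : gap f ψ (run.x (t + 1)) xs ≤ gap f ψ (run.x t) xs := by
  have h := (run.accepted t ht).2.2
  have hM := run.M_pos hM₀ t ht.le
  rw [Accept, ← run.x_succ t ht] at h
  have h0 : 0 ≤ gap f ψ (run.x t) (run.x (t + 1)) := le_trans (by positivity) h
  simp only [gap] at h0 ⊢
  linarith

lemma Alg2Run.gap_antitone (hM₀ : 0 < M₀) (run : Alg2Run f ψ M₀ ε T) (xs : E n) :
    ∀ t ≤ T, gap f ψ (run.x t) xs ≤ gap f ψ (run.x 0) xs := by
  intro t
  induction t with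
  | zero => intro _; rfl
  | succ t ih =>
    intro ht
    exact (run.gap_succ_le hM₀ xs (by omega)).trans (ih (by omega))

/-- Descent keeps x_{t+1} in the initial level set, so δ_{t+1} ≤ ‖g‖R. Inserting this into the
acceptance test gives δ_{t+1}^{4/3} ≤ 6N^{1/3}R^{4/3}(δ_t - δ_{t+1}), and the divisor is the cube of
that constant. -/
lemma Alg2Run.gap_step (hc : ConvexOn ℝ Set.univ f) (hf : ContDiff ℝ 3 f)
    (hL : ∀ x y, ‖iteratedFDeriv ℝ 3 f x - iteratedFDeriv ℝ 3 f y‖ ≤ L * ‖x - y‖)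
    (hψ : ConvexExt ψ) (hM₀ : 0 < M₀) (run : Alg2Run f ψ M₀ ε T) {xs : E n}
    (hxs : ∀ y, composite f ψ xs ≤ composite f ψ y) {R : ℝ} (hR : 0 < R)
    (hlevel : ∀ x, composite f ψ x ≤ composite f ψ (run.x 0) → ‖x - xs‖ ≤ R)
    {t : ℕ} (ht : t < T) :
    (gap f ψ (run.x (t + 1)) xs / (6 ^ 3 * (max (4 * M₀) (8 * L) * R ^ 4))) ^ (4 / 3 : ℝ) ≤
      gap f ψ (run.x t) xs / (6 ^ 3 * (max (4 * M₀) (8 * L) * R ^ 4))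
      - gap f ψ (run.x (t + 1)) xs / (6 ^ 3 * (max (4 * M₀) (8 * L) * R ^ 4)) := by
  set N := max (4 * M₀) (8 * L) with hN
  have hN0 : 0 < N := lt_max_of_lt_left (by linarith)
  have hdom := run.mem_effDom hψ
  have hxsd : xs ∈ effDom ψ := by
    have h := hxs (run.x 0)
    rw [composite_toReal hψ (hdom 0 (by omega))] at h
    by_contra hd
    have ht : ψ xs = ⊤ := not_lt_top_iff.1 hd
    rw [composite, ht, EReal.coe_add_top] at h
    exact absurd h (not_le.2 (EReal.coe_lt_top _))
  have hdist : ‖run.x (t + 1) - xs‖ ≤ R := by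
    refine hlevel _ ?_
    have h := run.gap_antitone hM₀ xs (t + 1) ht
    rw [gap_eq hψ (hdom _ ht) hxsd, gap_eq hψ (hdom _ (by omega)) hxsd] at h
    rw [composite_toReal hψ (hdom _ ht), composite_toReal hψ (hdom _ (by omega)),
      EReal.coe_le_coe_iff]
    linarith
  have hδ0 : 0 ≤ gap f ψ (run.x (t + 1)) xs := by
    have h := hxs (run.x (t + 1))
    rw [composite_toReal hψ (hdom _ ht), composite_toReal hψ hxsd, EReal.coe_le_coe_iff] at h
    rw [gap_eq hψ (hdom _ ht) hxsd]
    linarith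
  obtain ⟨G, hG⟩ := run.inner t ht _ ⟨run.istart_le t ht, le_rfl⟩
  obtain ⟨hd, u, hstep, hgp, -⟩ := hG.exists_step hψ
  have hacc := (run.accepted t ht).2.2
  have hsub := subgradient_composite hc hf hψ hstep hd hxsd
  rw [← hgp] at hsub
  have hM := run.accepted_le hc hf hL hψ hM₀ ht
  have hM0 := run.M_pos hM₀ t ht.le
  rw [← hN] at hM
  rw [Accept, ← run.x_succ t ht] at hacc
  rw [← run.x_succ t ht] at hsub
  set g := gradient f (run.x (t + 1)) + run.gp t (run.iacc t)
  have hgn : gap f ψ (run.x (t + 1)) xs ≤ ‖g‖ * R :=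
    hsub.trans ((real_inner_le_norm _ _).trans (by gcongr))
  have e : gap f ψ (run.x t) (run.x (t + 1)) =
      gap f ψ (run.x t) xs - gap f ψ (run.x (t + 1)) xs := by simp only [gap]; ring
  rw [e] at hacc
  rw [← sub_div]
  set δ := gap f ψ (run.x (t + 1)) xs
  set Δ := gap f ψ (run.x t) xs - δ
  set P := 2 ^ run.iacc t * run.M t with hP
  have hP0 : 0 < P := by positivity
  have hPN : P ^ (1 / 3 : ℝ) ≤ N ^ (1 / 3 : ℝ) := by gcongr
  have hc0 : 0 < N ^ (1 / 3 : ℝ) := Real.rpow_pos_of_pos hN0 _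
  have hcN := rpow_third_pow_three hN0.le
  have hp0 : 0 < P ^ (1 / 3 : ℝ) := Real.rpow_pos_of_pos hP0 _
  set c := N ^ (1 / 3 : ℝ)
  have h1 : (‖g‖ ^ (1 / 3 : ℝ)) ^ 4 ≤ 6 * c * Δ := by
    rw [rpow_four_thirds (norm_nonneg _), div_mul_eq_mul_div, one_mul,
      div_le_iff₀ (by positivity)] at hacc
    have hΔ : 0 ≤ Δ := by
      by_contra! hneg
      have : Δ * (6 * P ^ (1 / 3 : ℝ)) < 0 := mul_neg_of_neg_of_pos hneg (by positivity)
      have : 0 ≤ (‖g‖ ^ (1 / 3 : ℝ)) ^ 4 := by positivity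
      linarith
    calc _ ≤ Δ * (6 * P ^ (1 / 3 : ℝ)) := hacc
      _ ≤ Δ * (6 * c) := by gcongr
      _ = _ := by ring
  have hr0 : 0 < R ^ (1 / 3 : ℝ) := Real.rpow_pos_of_pos hR _
  have hr3 := rpow_third_pow_three hR.le
  set r := R ^ (1 / 3 : ℝ)
  have hd3 : δ ^ (1 / 3 : ℝ) ≤ ‖g‖ ^ (1 / 3 : ℝ) * r := by
    apply le_of_pow_three_le (by positivity)
    rw [rpow_third_pow_three hδ0, mul_pow, rpow_third_pow_three (norm_nonneg _), hr3]
    exact hgn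
  have hden : 6 ^ 3 * (N * R ^ 4) = (6 * c * r ^ 4) ^ 3 := by
    rw [← hcN, ← hr3]; ring
  have hroot : ((6 * c * r ^ 4) ^ 3) ^ (1 / 3 : ℝ) = 6 * c * r ^ 4 := by
    rw [← Real.rpow_natCast, ← Real.rpow_mul (by positivity)]; norm_num
  rw [hden, rpow_four_thirds (by positivity), Real.div_rpow hδ0 (by positivity), hroot, div_pow]
  have h2 : (δ ^ (1 / 3 : ℝ)) ^ 4 ≤ 6 * c * Δ * r ^ 4 :=
    calc _ ≤ (‖g‖ ^ (1 / 3 : ℝ) * r) ^ 4 := by gcongr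
      _ = (‖g‖ ^ (1 / 3 : ℝ)) ^ 4 * r ^ 4 := by ring
      _ ≤ _ := by gcongr
  rw [div_le_div_iff₀ (by positivity) (by positivity)]
  calc _ ≤ 6 * c * Δ * r ^ 4 * (6 * c * r ^ 4) ^ 3 := by gcongr
    _ = _ := by ring

end Run

end ThirdOrder

/-! ### The three bounds for the normalized gaps -/

theorem theorem3p1 {n : ℕ} (f : ThirdOrder.E n → ℝ) (ψ : ThirdOrder.E n → EReal)
    (L_f M₀ ε R₀ : ℝ) (hM₀ : 0 < M₀) (hε : 0 < ε) (hR₀ : 0 < R₀)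
    (hf_convex : ConvexOn ℝ Set.univ f) (hf_diff : ContDiff ℝ 3 f)
    (hf_lip : ∀ x y, ‖iteratedFDeriv ℝ 3 f x - iteratedFDeriv ℝ 3 f y‖ ≤ L_f * ‖x - y‖)
    (hψ : ThirdOrder.ConvexExt ψ)
    (xstar : ThirdOrder.E n)
    (hxstar : ∀ y, ThirdOrder.composite f ψ xstar ≤ ThirdOrder.composite f ψ y)
    (T : ℕ) (run : ThirdOrder.Alg2Run f ψ M₀ ε T)
    (hlevel : ∀ x, ThirdOrder.composite f ψ x ≤ ThirdOrder.composite f ψ (run.x 0) →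
      ‖x - xstar‖ ≤ R₀)
    (htrial : ∀ t < T, ∀ i ∈ Set.Icc (run.istart t) (run.iacc t),
      ε ≤ min ‖gradient f (run.xp t i) + run.gp t i‖ (ThirdOrder.gap f ψ (run.xp t i) xstar))
    (m : ℕ)
    (hm : IsLeast {k : ℕ | ThirdOrder.gap f ψ (run.x k) xstar
      ≤ 6 ^ 3 * (4 * max (2 * M₀) (4 * L_f) * R₀ ^ 4)} m)
    (hmT : m < T) :
    (0 < m → (m : ℝ) ≤ 1 + 1 / Real.logb 2 (4 / 3) *
      Real.logb 2 (Real.logb 2 (ThirdOrder.gap f ψ (run.x 0) xstar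
        / (6 ^ 3 * (max (4 * M₀) (8 * L_f) * R₀ ^ 4))))) ∧
    (∀ k, m < k → k ≤ T → ThirdOrder.gap f ψ (run.x k) xstar
      ≤ 42 ^ 3 * max (4 * M₀) (8 * L_f) * R₀ ^ 4 / ((k : ℝ) - m) ^ 3) ∧
    (T : ℝ) ≤ m + 42 * max (4 * M₀) (8 * L_f) ^ (1 / 3 : ℝ) * R₀ ^ (4 / 3 : ℝ)
      * ε ^ (-(1 / 3) : ℝ) := by

  have hN : max (2 * M₀) (4 * L_f) * 2 = max (4 * M₀) (8 * L_f) := by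
    rw [max_mul_of_nonneg _ _ (by norm_num)]
    congr 1 <;> ring
  have hN0 : 0 < max (4 * M₀) (8 * L_f) := lt_max_of_lt_left (by linarith)
  set N := max (4 * M₀) (8 * L_f) with hNdef
  set δ : ℕ → ℝ := fun k => ThirdOrder.gap f ψ (run.x k) xstar with hδ
  have hC : 0 < 6 ^ 3 * (N * R₀ ^ 4) := by positivity
  set u : ℕ → ℝ := fun k => δ k / (6 ^ 3 * (N * R₀ ^ 4)) with hu
  have hstep : ∀ k < T, u (k + 1) ^ (4 / 3 : ℝ) ≤ u k - u (k + 1) := fun k hk =>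
    run.gap_step hf_convex hf_diff hf_lip hψ hM₀ hxstar hR₀ hlevel hk
  -- Only k > 0 is available: x₀ is not a trial point.
  have hδε : ∀ k, 0 < k → k ≤ T → ε ≤ δ k := by
    intro k hk hkT
    obtain ⟨t, rfl⟩ := Nat.exists_eq_add_of_le' hk
    have h := (htrial t (by omega) (run.iacc t) ⟨run.istart_le t (by omega), le_rfl⟩).trans
      (min_le_right _ _)
    rwa [← run.x_succ t (by omega)] at h
  have hset : 6 ^ 3 * (4 * max (2 * M₀) (4 * L_f) * R₀ ^ 4) = 2 * (6 ^ 3 * (N * R₀ ^ 4)) := by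
    rw [← hN]; ring
  have hrate : ∀ k, m < k → k ≤ T → δ k ≤ 42 ^ 3 * N * R₀ ^ 4 / ((k : ℝ) - m) ^ 3 := by
    intro k hmk hkT
    have hm2 : u m ≤ 2 := by
      have h : δ m ≤ 6 ^ 3 * (4 * max (2 * M₀) (4 * L_f) * R₀ ^ 4) := hm.1
      rw [hset] at h
      exact (div_le_iff₀ hC).2 h
    have h := ThirdOrder.cubic_decay (u := u) (m := m) (T := T)
      (fun k hk hkT => div_pos (hε.trans_le (hδε k (by omega) hkT)) hC) hm2
      (fun k hk _ => hstep k hk) hmk hkT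
    rw [hu] at h
    have h' := (div_le_iff₀ hC).1 h
    refine h'.trans (le_of_eq ?_)
    ring
  refine ⟨fun hm0 => ?_, hrate, ?_⟩
  · obtain ⟨j, rfl⟩ := Nat.exists_eq_add_of_le' hm0
    -- Minimality of m is used at j = m - 1, the last index with u > 2; this shift produces the
    -- summand 1.
    have hj : 2 < u j := by
      have h : ¬ δ j ≤ 6 ^ 3 * (4 * max (2 * M₀) (4 * L_f) * R₀ ^ 4) := fun h => by
        have := hm.2 h
        omega
      rw [hset, not_le] at h
      exact (lt_div_iff₀ hC).2 h
    have h := ThirdOrder.doubly_log_bound hj (fun k hk => hstep k (by omega))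
    have h0 : u 0 = ThirdOrder.gap f ψ (run.x 0) xstar / (6 ^ 3 * (N * R₀ ^ 4)) := rfl
    rw [h0] at h
    push_cast
    linarith
  · have hmT' : (0 : ℝ) < (T : ℝ) - m := by
      rw [sub_pos]; exact_mod_cast hmT
    have h := (hδε T (by omega) le_rfl).trans (hrate T hmT le_rfl)
    rw [le_div_iff₀ (by positivity)] at h
    have hR43 := ThirdOrder.rpow_four_thirds hR₀.le
    have hR3 := ThirdOrder.rpow_third_pow_three hR₀.le
    have hN3 := ThirdOrder.rpow_third_pow_three hN0.le
    have hε3 := ThirdOrder.rpow_third_pow_three hε.le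
    have hεp : 0 < ε ^ (1 / 3 : ℝ) := Real.rpow_pos_of_pos hε _
    have hNp : 0 < N ^ (1 / 3 : ℝ) := Real.rpow_pos_of_pos hN0 _
    have hRp : 0 < R₀ ^ (1 / 3 : ℝ) := Real.rpow_pos_of_pos hR₀ _
    have key : (T : ℝ) - m ≤ 42 * N ^ (1 / 3 : ℝ) * R₀ ^ (4 / 3 : ℝ) * ε ^ (-(1 / 3) : ℝ) := by
      rw [Real.rpow_neg hε.le, ← div_eq_mul_inv, le_div_iff₀ hεp]
      apply ThirdOrder.le_of_pow_three_le (by positivity)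
      rw [hR43]
      calc (((T : ℝ) - m) * ε ^ (1 / 3 : ℝ)) ^ 3
          = (ε ^ (1 / 3 : ℝ)) ^ 3 * ((T : ℝ) - m) ^ 3 := by ring
        _ = ε * ((T : ℝ) - m) ^ 3 := by rw [hε3]
        _ ≤ 42 ^ 3 * N * R₀ ^ 4 := h
        _ = 42 ^ 3 * (N ^ (1 / 3 : ℝ)) ^ 3 * ((R₀ ^ (1 / 3 : ℝ)) ^ 3) ^ 4 := by rw [hN3, hR3]
        _ = _ := by ring
    linarith
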